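/- \textbf{Conventions.} All Hilbert spaces are finite-dimensional and complex. For a positive operator $\rho_{AB}$ on $\mathcal H_A\otimes\mathcal H_B$, $\rho_A=\operatorname{tr}_B\rho_{AB}$ and $\rho_B=\operatorname{tr}_A\rho_{AB}$. A normalized (subnormalized) state is a positive operator of trace $1$ (at most $1$). Put $\|M\|_1=\operatorname{tr}\sqrt{M^\dagger M}$. For subnormalized states let $$F(\rho,\sigma)=\|\sqrt\rho\sqrt\sigma\|_1,\qquad \bar F(\rho,\sigma)=F(\rho,\sigma)+\sqrt{(1-\operatorname{tr}\rho)(1-\operatorname{tr}\sigma)},\qquad P(\rho,\sigma)=\sqrt{1-\bar F(\rho,\sigma)^2}.$$ For a subnormalized state $\rho_{AB}$ and $\varepsilon\ge 0$ define, with values in $[-\infty,+\infty]$, $$H_{\min}(A|B)_\rho=\sup_{\sigma_B}\ \sup\{\lambda\in\mathbb R:\ 2^{-\lambda}\,\mathbb I_A\otimes\sigma_B-\rho_{AB}\ge 0\},\qquad H_{\min}^{\varepsilon}(A|B)_\rho=\sup_{\hat\rho_{AB}}H_{\min}(A|B)_{\hat\rho},$$ where $\sigma_B$ ranges over the normalized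 states on $\mathcal H_B$, and $\hat\rho_{AB}$ over the subnormalized states on $\mathcal H_A\otimes\mathcal H_B$ with $P(\hat\rho,\rho)\le\varepsilon$; moreover $2^{-\infty}=0$. Fix an orthonormal basis $\{|x\rangle\}$ of $\mathcal H_A$, let $|A|=\dim\mathcal H_A$, let $A'$ be a copy of $A$, and let $|\Phi\rangle_{A'A}=|A|^{-1/2}\sum_x|x\rangle_{A'}\otimes|x\rangle_A$. The Choi--Jamio\l{}kowski operator of a linear map $\mathcal T$ from operators on $\mathcal H_A$ to operators on $\mathcal H_B$ is $J(\mathcal T)=(\mathcal I_{A'}\otimes\mathcal T)(|\Phi\rangle\langle\Phi|_{A'A})$, an operator on $\mathcal H_{A'}\otimes\mathcal H_B\cong\mathcal H_A\otimes\mathcal H_B$. \textbf{Theorem (Decoupling theorem).} Let $\varepsilon>0$, let $\rho_{AE}$ be a normalized state on $\mathcal H_A\otimes\mathcal H_E$, and let $\mathcal T$ be a completely positive map from operators on $\mathcal H_A$ to operators on $\mathcal H_B$ whose Choi--Jamio\l{}kowski operator $\tau_{AB}=J(\mathcal T)$ satisfies $\operatorname{tr}(\tau_{AB})\le 1$. Then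 $$\int_{\mathbb U(A)}\left\|\mathcal T(U\rho_{AE}U^\dagger)-\tau_B\otimes\rho_E\right\|_1\,dU\ \le\ 2^{-\frac12 H_{\min}^{\varepsilon}(A|E)_\rho-\frac12 H_{\min}^{\varepsilon}(A|B)_\tau}+12\,\varepsilon,$$ where $dU$ is the normalized Haar measure on the group $\mathbb U(A)$ of unitaries on $\mathcal H_A$, $U$ acts as $U\otimes\mathbb I_E$, and $\mathcal T$ acts as $\mathcal T\otimes\mathcal I_E$. -/

import Mathlib

open MeasureTheory
open scoped Matrix Kronecker ENNReal ComplexOrder MatrixOrder Matrix.Norms.L2Operator CStarAlgebra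

/-! Finite-dimensional Hilbert spaces are `ℂ^A` for a finite index type `A` (the fixed orthonormal
basis), operators on them are `Matrix A A ℂ`, and the composite system `AB` has index type
`A × B`. -/

namespace Decoupling

noncomputable section

/-- Subnormalized states: positive operators of trace at most one. -/
def IsSubnormalized {A : Type*} [Fintype A] (ρ : Matrix A A ℂ) : Prop :=
  ρ.PosSemidef ∧ ρ.trace.re ≤ 1

/-- Normalized states: positive operators of trace one. -/
def IsNormalized {A : Type*} [Fintype A] (ρ : Matrix A A ℂ) : Prop :=
  ρ.PosSemidef ∧ ρ.trace = 1

/-- The reduced operator on the first factor. -/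
def reduceFst {A B : Type*} [Fintype B] (ρ : Matrix (A × B) (A × B) ℂ) : Matrix A A ℂ :=
  Matrix.of fun a a' => ∑ b, ρ (a, b) (a', b)

/-- The reduced operator on the second factor. -/
def reduceSnd {A B : Type*} [Fintype A] (ρ : Matrix (A × B) (A × B) ℂ) : Matrix B B ℂ :=
  Matrix.of fun b b' => ∑ a, ρ (a, b) (a, b')

/-- The trace norm `‖M‖₁ = tr √(M† M)`. -/
def traceNorm {A : Type*} [Fintype A] [DecidableEq A] (M : Matrix A A ℂ) : ℝ :=
  (Matrix.trace (CFC.sqrt (Mᴴ * M))).re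

/-- The fidelity `F(ρ, σ) = ‖√ρ √σ‖₁`. -/
def fidelity {A : Type*} [Fintype A] [DecidableEq A] (ρ σ : Matrix A A ℂ) : ℝ :=
  traceNorm (CFC.sqrt ρ * CFC.sqrt σ)

/-- The generalized fidelity of subnormalized states. -/
def genFidelity {A : Type*} [Fintype A] [DecidableEq A] (ρ σ : Matrix A A ℂ) : ℝ :=
  fidelity ρ σ + Real.sqrt ((1 - ρ.trace.re) * (1 - σ.trace.re))

/-- The purified distance of subnormalized states. -/
def purifiedDist {A : Type*} [Fintype A] [DecidableEq A] (ρ σ : Matrix A A ℂ) : ℝ :=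
  Real.sqrt (1 - genFidelity ρ σ ^ 2)

/-- The `ε`-ball of subnormalized states around `ρ` in purified distance. -/
def smoothingBall {A : Type*} [Fintype A] [DecidableEq A] (ε : ℝ) (ρ : Matrix A A ℂ) :
    Set (Matrix A A ℂ) :=
  {ρ' | IsSubnormalized ρ' ∧ purifiedDist ρ' ρ ≤ ε}

/-- The min-entropy `H_min(A|B)_ρ`, i.e. the supremum of all real `l` such that
`2^(-l) 1_A ⊗ σ_B - ρ_AB ≥ 0` for some normalized `σ_B`. It takes the value `⊤` at `ρ = 0`. -/
def minEntropy {A B : Type*} [Fintype A] [DecidableEq A] [Fintype B]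
    (ρ : Matrix (A × B) (A × B) ℂ) : EReal :=
  ⨆ (σ : Matrix B B ℂ) (_ : IsNormalized σ), ⨆ (l : ℝ)
    (_ : (((2 : ℝ) ^ (-l)) • ((1 : Matrix A A ℂ) ⊗ₖ σ) - ρ).PosSemidef), (l : EReal)

/-- The `ε`-smooth min-entropy `H_min^ε(A|B)_ρ`. -/
def smoothMinEntropy {A B : Type*} [Fintype A] [DecidableEq A] [Fintype B] [DecidableEq B]
    (ε : ℝ) (ρ : Matrix (A × B) (A × B) ℂ) : EReal :=
  ⨆ ρ' ∈ smoothingBall ε ρ, minEntropy ρ'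

/-- The function `x ↦ 2^x` on the extended reals. -/
def exp2 : EReal → ℝ≥0∞
  | ⊥ => 0
  | ⊤ => ⊤
  | (x : ℝ) => ENNReal.ofReal ((2 : ℝ) ^ x)

/-- The operator `|Φ⟩⟨Φ|` on `A' A`, where `Φ = |A|^(-1/2) ∑ x, |x⟩ ⊗ |x⟩`. -/
def maxEntangled (A : Type*) [Fintype A] [DecidableEq A] : Matrix (A × A) (A × A) ℂ :=
  let Φ : A × A → ℂ := fun p =>
    (((Real.sqrt (Fintype.card A))⁻¹ : ℝ) : ℂ) * if p.1 = p.2 then 1 else 0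
  Matrix.vecMulVec Φ (star Φ)

/-- `T ⊗ I_E`, acting on operators on `A E`. -/
def applyFst {A B : Type*} (E : Type*) (T : Matrix A A ℂ →ₗ[ℂ] Matrix B B ℂ)
    (X : Matrix (A × E) (A × E) ℂ) : Matrix (B × E) (B × E) ℂ :=
  Matrix.of fun p q => T (Matrix.of fun a a' => X (a, p.2) (a', q.2)) p.1 q.1

/-- `I_R ⊗ T`, acting on operators on `R A`. -/
def applySnd {A B : Type*} (R : Type*) (T : Matrix A A ℂ →ₗ[ℂ] Matrix B B ℂ)
    (X : Matrix (R × A) (R × A) ℂ) : Matrix (R × B) (R × B) ℂ :=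
  Matrix.of fun p q => T (Matrix.of fun a a' => X (p.1, a) (q.1, a')) p.2 q.2

/-- On product operators `T ⊗ I_E` acts as it should; by linearity this determines it. -/
theorem applyFst_kronecker {A B E : Type*} (T : Matrix A A ℂ →ₗ[ℂ] Matrix B B ℂ)
    (X : Matrix A A ℂ) (Y : Matrix E E ℂ) : applyFst E T (X ⊗ₖ Y) = T X ⊗ₖ Y := by
  ext p q
  have h : (Matrix.of fun a a' => (X ⊗ₖ Y) (a, p.2) (a', q.2)) = Y p.2 q.2 • X := by
    ext a a'
    simp [Matrix.kroneckerMap_apply, mul_comm]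
  rw [applyFst, Matrix.of_apply, h, map_smul, Matrix.smul_apply, smul_eq_mul, mul_comm]
  rfl

/-- On product operators `I_R ⊗ T` acts as it should; by linearity this determines it. -/
theorem applySnd_kronecker {A B R : Type*} (T : Matrix A A ℂ →ₗ[ℂ] Matrix B B ℂ)
    (Y : Matrix R R ℂ) (X : Matrix A A ℂ) : applySnd R T (Y ⊗ₖ X) = Y ⊗ₖ T X := by
  ext p q
  have h : (Matrix.of fun a a' => (Y ⊗ₖ X) (p.1, a) (q.1, a')) = Y p.1 q.1 • X := by
    ext a a'
    simp [Matrix.kroneckerMap_apply]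
  rw [applySnd, Matrix.of_apply, h, map_smul, Matrix.smul_apply, smul_eq_mul]
  rfl

/-- The Choi-Jamiołkowski representation `J(T) = (I_A' ⊗ T)(|Φ⟩⟨Φ|)`. -/
def choi {A B : Type*} [Fintype A] [DecidableEq A] (T : Matrix A A ℂ →ₗ[ℂ] Matrix B B ℂ) :
    Matrix (A × B) (A × B) ℂ :=
  applySnd A T (maxEntangled A)

instance {A : Type*} [Fintype A] [DecidableEq A] :
    MeasurableSpace (Matrix.unitaryGroup A ℂ) := borel _

instance {A : Type*} [Fintype A] [DecidableEq A] :
    BorelSpace (Matrix.unitaryGroup A ℂ) := ⟨rfl⟩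

instance {A : Type*} [Fintype A] [DecidableEq A] :
    CompactSpace (Matrix.unitaryGroup A ℂ) := by
  have : ProperSpace (Matrix A A ℂ) := FiniteDimensional.proper ℂ _
  refine isCompact_iff_compactSpace.1 (Metric.isCompact_of_isClosed_isBounded ?_ ?_)
  · exact isClosed_unitary (R := Matrix A A ℂ)
  · cases isEmpty_or_nonempty A
    · exact (Set.toFinite _).isBounded
    · refine (Metric.isBounded_iff_subset_closedBall (0 : Matrix A A ℂ)).2 ⟨1, fun U hU => ?_⟩
      rw [mem_closedBall_zero_iff]
      exact (CStarRing.norm_of_mem_unitary hU).le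

/-- The Haar measure on the unitary group, normalized to total mass one. -/
def haarUnitary (A : Type*) [Fintype A] [DecidableEq A] : Measure (Matrix.unitaryGroup A ℂ) :=
  Measure.haarMeasure ⊤

instance {A : Type*} [Fintype A] [DecidableEq A] : IsProbabilityMeasure (haarUnitary A) :=
  ⟨by simpa [haarUnitary] using
    Measure.haarMeasure_self (K₀ := (⊤ : TopologicalSpace.PositiveCompacts
      (Matrix.unitaryGroup A ℂ)))⟩

/-- The conjugate `U X U†` of an operator on `A E` by a unitary on `A`. -/
def conjFst {A E : Type*} [Fintype A] [DecidableEq A] [Fintype E] [DecidableEq E]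
    (U : Matrix.unitaryGroup A ℂ) (X : Matrix (A × E) (A × E) ℂ) : Matrix (A × E) (A × E) ℂ :=
  ((U : Matrix A A ℂ) ⊗ₖ (1 : Matrix E E ℂ)) * X * ((U : Matrix A A ℂ) ⊗ₖ (1 : Matrix E E ℂ))ᴴ

/-- The decoupling error `‖T(U ρ_AE U†) - τ_B ⊗ ρ_E‖₁`, where `τ_AB = J(T)`. -/
def decouplingError {A B E : Type*} [Fintype A] [DecidableEq A] [Fintype B] [DecidableEq B]
    [Fintype E] [DecidableEq E] (T : Matrix A A ℂ →ₗ[ℂ] Matrix B B ℂ)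
    (ρ : Matrix (A × E) (A × E) ℂ) (U : Matrix.unitaryGroup A ℂ) : ℝ :=
  traceNorm (applyFst E T (conjFst U ρ) - reduceSnd (choi T) ⊗ₖ reduceSnd ρ)

end

end Decoupling

/-! Write `D` for the difference `T(U X U†) - τ_B ⊗ X_E`, regarded as a bilinear expression in the
Choi-Jamiołkowski operator `τ` of `T` and in `X`. It depends only on the part of `X` orthogonal to
`1 ⊗ M`, and `tr (D† D)` involves `U` only through two copies of `U ⊗ U†`. A bilinear form on
matrices invariant under unitary conjugation is a combination of `tr (X Y)` and `tr X tr Y`, so the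
Haar average of `tr (D† D)` can be computed; it is at most `tr (τ†τ) tr (X†X)`.

To pass to the trace norm, let `1 ⊗ ω` dominate `τ` and `1 ⊗ σ` dominate `X`. Conjugating `τ` by
`ω^(-1/4)` and `X` by `σ^(-1/4)` conjugates `D` by `ω^(-1/4) ⊗ σ^(-1/4)`, and Hölder's inequality
bounds `‖D‖₁` by `√(tr ω tr σ)` times the Hilbert-Schmidt norm of the conjugated `D`. The
conjugated operators have Hilbert-Schmidt norms at most `√(tr τ)` and `√(tr X)`, by domination.
When `l` and `m` lie below the two min-entropies, `ω` and `σ` can be chosen of traces `2^(-l)` and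
`2^(-m)`.

Smoothing costs a linear error: a purified distance of `ε` bounds the trace distance by `2 ε`, and
the average of `‖D‖₁` is at most `2 ‖τ‖₁ ‖X‖₁`. Replacing each of the two states in turn therefore
changes the average by at most `4 ε`. -/

namespace Decoupling

open Matrix (unitaryGroup)

section HilbertSchmidt

variable {m n : Type*} [Fintype m] [Fintype n]

theorem re_trace_conjTranspose (M : Matrix n n ℂ) : Mᴴ.trace.re = M.trace.re := by
  rw [Matrix.trace_conjTranspose, Complex.star_def, Complex.conj_re]

theorem re_trace_nonneg {ρ : Matrix n n ℂ} (hρ : ρ.PosSemidef) : 0 ≤ ρ.trace.re :=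
  (Complex.nonneg_iff.1 hρ.trace_nonneg).1

/-- The square `tr (M† M)` of the Hilbert-Schmidt norm. -/
noncomputable def hsNormSq (M : Matrix m n ℂ) : ℝ := (Mᴴ * M).trace.re

theorem hsNormSq_eq_sum (M : Matrix m n ℂ) : hsNormSq M = ∑ i, ∑ j, ‖M i j‖ ^ 2 := by
  rw [hsNormSq, Matrix.trace, Complex.re_sum, Finset.sum_comm]
  refine Finset.sum_congr rfl fun j _ => ?_
  rw [Matrix.diag_apply, Matrix.mul_apply, Complex.re_sum]
  refine Finset.sum_congr rfl fun i _ => ?_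
  rw [Matrix.conjTranspose_apply, Complex.star_def, Complex.conj_mul', ← Complex.ofReal_pow,
    Complex.ofReal_re]

theorem hsNormSq_nonneg (M : Matrix m n ℂ) : 0 ≤ hsNormSq M :=
  re_trace_nonneg (Matrix.posSemidef_conjTranspose_mul_self M)

theorem hsNormSq_conjTranspose (M : Matrix m n ℂ) : hsNormSq Mᴴ = hsNormSq M := by
  rw [hsNormSq, hsNormSq, Matrix.conjTranspose_conjTranspose, Matrix.trace_mul_comm]

theorem hsNormSq_of_isHermitian {M : Matrix n n ℂ} (hM : M.IsHermitian) :
    hsNormSq M = (M * M).trace.re := by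
  rw [hsNormSq, hM.eq]

theorem hsNormSq_add (M N : Matrix m n ℂ) :
    hsNormSq (M + N) = hsNormSq M + hsNormSq N + 2 * (Mᴴ * N).trace.re := by
  have hcross : (Nᴴ * M).trace.re = (Mᴴ * N).trace.re := by
    rw [← re_trace_conjTranspose, Matrix.conjTranspose_mul, Matrix.conjTranspose_conjTranspose]
  simp only [hsNormSq, Matrix.conjTranspose_add, Matrix.add_mul, Matrix.mul_add, Matrix.trace_add,
    Complex.add_re, hcross]
  ring

theorem hsNormSq_sub (M N : Matrix m n ℂ) :
    hsNormSq (M - N) = hsNormSq M + hsNormSq N - 2 * (Mᴴ * N).trace.re := by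
  have hneg : hsNormSq (-N) = hsNormSq N := by
    rw [hsNormSq, hsNormSq, Matrix.conjTranspose_neg, Matrix.neg_mul, Matrix.mul_neg,
      neg_neg]
  rw [sub_eq_add_neg, hsNormSq_add, hneg, Matrix.mul_neg, Matrix.trace_neg, Complex.neg_re]
  ring

theorem norm_trace_mul_le (X : Matrix m n ℂ) (Y : Matrix n m ℂ) :
    ‖(X * Y).trace‖ ≤ √(hsNormSq X) * √(hsNormSq Y) := by
  rw [← hsNormSq_conjTranspose Y, hsNormSq_eq_sum, hsNormSq_eq_sum]
  simp only [Matrix.trace, Matrix.diag_apply, Matrix.mul_apply, Matrix.conjTranspose_apply,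
    norm_star, ← Fintype.sum_prod_type']
  calc ‖∑ p : m × n, X p.1 p.2 * Y p.2 p.1‖
      ≤ ∑ p : m × n, ‖X p.1 p.2‖ * ‖Y p.2 p.1‖ := by
        simpa only [norm_mul] using norm_sum_le _ fun p : m × n => X p.1 p.2 * Y p.2 p.1
    _ ≤ _ := Real.sum_mul_le_sqrt_mul_sqrt _ _ _

theorem continuous_hsNormSq : Continuous (hsNormSq : Matrix m n ℂ → ℝ) := by
  unfold hsNormSq
  fun_prop

theorem hsNormSq_unitary_mul [DecidableEq m] (V : unitaryGroup m ℂ) (M : Matrix m n ℂ) :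
    hsNormSq ((V : Matrix m m ℂ) * M) = hsNormSq M := by
  rw [hsNormSq, hsNormSq, Matrix.conjTranspose_mul, Matrix.mul_assoc,
    ← Matrix.mul_assoc _ (V : Matrix m m ℂ) M, ← Matrix.star_eq_conjTranspose (V : Matrix m m ℂ),
    Unitary.coe_star_mul_self, Matrix.one_mul]

end HilbertSchmidt

section PolarDecomposition

theorem exists_linearIsometry_apply_eq {𝕜 V W : Type*} [RCLike 𝕜] [NormedAddCommGroup V]
    [InnerProductSpace 𝕜 V] [FiniteDimensional 𝕜 V] [AddCommGroup W] [Module 𝕜 W]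
    {S T : W →ₗ[𝕜] V} (h : ∀ w, ‖S w‖ = ‖T w‖) : ∃ U : V →ₗᵢ[𝕜] V, ∀ w, U (S w) = T w := by
  have hker : LinearMap.ker S ≤ LinearMap.ker T := fun w hw => by
    rw [LinearMap.mem_ker, ← norm_eq_zero] at hw ⊢
    rw [← h, hw]
  let L : LinearMap.range S →ₗ[𝕜] V :=
    (LinearMap.ker S).liftQ T hker ∘ₗ S.quotKerEquivRange.symm.toLinearMap
  have hL (w : W) : L ⟨S w, w, rfl⟩ = T w := by
    have hw : S.quotKerEquivRange.symm ⟨S w, w, rfl⟩ = (LinearMap.ker S).mkQ w :=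
      S.quotKerEquivRange_symm_apply_image w _
    simp [L, hw]
  have hLnorm : ∀ x, ‖L x‖ = ‖x‖ := by
    rintro ⟨_, w, rfl⟩
    rw [hL, ← h, Submodule.coe_norm]
  let Lᵢ : LinearMap.range S →ₗᵢ[𝕜] V := ⟨L, hLnorm⟩
  exact ⟨Lᵢ.extend, fun w => (Lᵢ.extend_apply ⟨S w, w, rfl⟩).trans (hL w)⟩

theorem exists_unitary_mul_eq {n : Type*} [Fintype n] [DecidableEq n] {M N : Matrix n n ℂ}
    (h : Mᴴ * M = Nᴴ * N) : ∃ V : unitaryGroup n ℂ, (V : Matrix n n ℂ) * M = N := by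
  let φ := Matrix.toEuclideanCLM (n := n) (𝕜 := ℂ)
  have hnorm (v : EuclideanSpace ℂ n) : ‖φ M v‖ = ‖φ N v‖ := by
    rw [ContinuousLinearMap.apply_norm_eq_sqrt_inner_adjoint_left,
      ContinuousLinearMap.apply_norm_eq_sqrt_inner_adjoint_left]
    have : star (φ M) * φ M = star (φ N) * φ N := by
      rw [← map_star, ← map_mul, ← map_star, ← map_mul]
      exact congrArg φ h
    exact congrArg (fun S : EuclideanSpace ℂ n →L[ℂ] EuclideanSpace ℂ n =>
      √(RCLike.re (inner ℂ (S v) v))) this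
  obtain ⟨U, hU⟩ := exists_linearIsometry_apply_eq (S := (φ M).toLinearMap)
    (T := (φ N).toLinearMap) hnorm
  have hUU : star U.toContinuousLinearMap * U.toContinuousLinearMap = 1 :=
    (ContinuousLinearMap.norm_map_iff_adjoint_comp_self _).1 U.norm_map
  obtain ⟨V, hV⟩ : ∃ V, φ V = U.toContinuousLinearMap := ⟨_, φ.apply_symm_apply _⟩
  have hVV : φ (star V * V) = φ 1 := by rw [map_mul, map_star, hV, hUU, map_one]
  have hVM : φ (V * M) = φ N := by
    rw [map_mul, hV]
    exact ContinuousLinearMap.ext hU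
  exact ⟨⟨V, Matrix.mem_unitaryGroup_iff'.2 (φ.injective hVV)⟩, φ.injective hVM⟩

theorem exists_unitary_mul_abs {n : Type*} [Fintype n] [DecidableEq n] (M : Matrix n n ℂ) :
    ∃ V : unitaryGroup n ℂ, (V : Matrix n n ℂ) * CFC.abs M = M := by
  refine exists_unitary_mul_eq ?_
  have hsa : (CFC.abs M)ᴴ = CFC.abs M := (CFC.abs_nonneg M).isSelfAdjoint
  rw [hsa, CFC.abs_mul_abs, Matrix.star_eq_conjTranspose]

end PolarDecomposition

section TraceNorm

variable {n : Type*} [Fintype n] [DecidableEq n]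

theorem traceNorm_eq_re_trace_abs (M : Matrix n n ℂ) : traceNorm M = (CFC.abs M).trace.re := rfl

theorem traceNorm_of_posSemidef {M : Matrix n n ℂ} (hM : M.PosSemidef) :
    traceNorm M = M.trace.re := by
  rw [traceNorm_eq_re_trace_abs, CFC.abs_of_nonneg M hM.nonneg]

theorem traceNorm_zero : traceNorm (0 : Matrix n n ℂ) = 0 := by
  rw [traceNorm_of_posSemidef .zero, Matrix.trace_zero, Complex.zero_re]

theorem continuous_traceNorm : Continuous (traceNorm : Matrix n n ℂ → ℝ) :=
  Complex.continuous_re.comp (CFC.continuous_abs.matrix_trace)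

theorem norm_trace_unitary_mul_posSemidef_le (V : unitaryGroup n ℂ) {P : Matrix n n ℂ}
    (hP : P.PosSemidef) : ‖((V : Matrix n n ℂ) * P).trace‖ ≤ P.trace.re := by
  have hR : (CFC.sqrt P).IsHermitian := (CFC.sqrt_nonneg P).isSelfAdjoint
  have hRR : CFC.sqrt P * CFC.sqrt P = P := CFC.sqrt_mul_sqrt_self P hP.nonneg
  calc ‖((V : Matrix n n ℂ) * P).trace‖
      = ‖((V : Matrix n n ℂ) * CFC.sqrt P * CFC.sqrt P).trace‖ := by rw [Matrix.mul_assoc, hRR]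
    _ ≤ √(hsNormSq (CFC.sqrt P)) * √(hsNormSq (CFC.sqrt P)) := by
        simpa only [hsNormSq_unitary_mul] using
          norm_trace_mul_le ((V : Matrix n n ℂ) * CFC.sqrt P) (CFC.sqrt P)
    _ = P.trace.re := by
        rw [Real.mul_self_sqrt (hsNormSq_nonneg _), hsNormSq_of_isHermitian hR, hRR]

theorem norm_trace_unitary_mul_le (V : unitaryGroup n ℂ) (M : Matrix n n ℂ) :
    ‖((V : Matrix n n ℂ) * M).trace‖ ≤ traceNorm M := by
  obtain ⟨W, hW⟩ := exists_unitary_mul_abs M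
  have := norm_trace_unitary_mul_posSemidef_le (V * W)
    (Matrix.nonneg_iff_posSemidef.1 (CFC.abs_nonneg M))
  rwa [Submonoid.coe_mul, Matrix.mul_assoc, hW] at this

theorem re_trace_unitary_mul_le (V : unitaryGroup n ℂ) (M : Matrix n n ℂ) :
    ((V : Matrix n n ℂ) * M).trace.re ≤ traceNorm M :=
  (Complex.re_le_norm _).trans (norm_trace_unitary_mul_le V M)

theorem exists_unitary_re_trace_mul_eq (M : Matrix n n ℂ) :
    ∃ V : unitaryGroup n ℂ, ((V : Matrix n n ℂ) * M).trace.re = traceNorm M := by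
  obtain ⟨W, hW⟩ := exists_unitary_mul_abs M
  refine ⟨star W, ?_⟩
  nth_rw 1 [← hW]
  rw [← Matrix.mul_assoc, Unitary.coe_star, Unitary.coe_star_mul_self, Matrix.one_mul,
    traceNorm_eq_re_trace_abs]

theorem traceNorm_nonneg (M : Matrix n n ℂ) : 0 ≤ traceNorm M :=
  re_trace_nonneg (Matrix.nonneg_iff_posSemidef.1 (CFC.abs_nonneg M))

theorem traceNorm_neg (M : Matrix n n ℂ) : traceNorm (-M) = traceNorm M := by
  rw [traceNorm_eq_re_trace_abs, CFC.abs_neg, traceNorm_eq_re_trace_abs]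

theorem traceNorm_add_le (M N : Matrix n n ℂ) : traceNorm (M + N) ≤ traceNorm M + traceNorm N := by
  obtain ⟨V, hV⟩ := exists_unitary_re_trace_mul_eq (M + N)
  rw [← hV, Matrix.mul_add, Matrix.trace_add, Complex.add_re]
  exact add_le_add (re_trace_unitary_mul_le V M) (re_trace_unitary_mul_le V N)

theorem traceNorm_sub_le (M N : Matrix n n ℂ) : traceNorm (M - N) ≤ traceNorm M + traceNorm N := by
  rw [sub_eq_add_neg, ← traceNorm_neg N]
  exact traceNorm_add_le _ _

theorem traceNorm_smul (c : ℂ) (M : Matrix n n ℂ) : traceNorm (c • M) = ‖c‖ * traceNorm M := by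
  rw [traceNorm_eq_re_trace_abs, CFC.abs_smul, Matrix.trace_smul, Complex.smul_re, smul_eq_mul,
    traceNorm_eq_re_trace_abs]

theorem traceNorm_mul_le (X Y : Matrix n n ℂ) :
    traceNorm (X * Y) ≤ √(hsNormSq X) * √(hsNormSq Y) := by
  obtain ⟨V, hV⟩ := exists_unitary_re_trace_mul_eq (X * Y)
  rw [← hV, ← Matrix.mul_assoc, ← hsNormSq_unitary_mul V X]
  exact (Complex.re_le_norm _).trans (norm_trace_mul_le _ _)

theorem hsNormSq_mul_unitary_mul_le {K : Matrix n n ℂ} (hK : K.IsHermitian)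
    (V : unitaryGroup n ℂ) : hsNormSq (K * (V : Matrix n n ℂ) * K) ≤ hsNormSq (K * K) := by
  have htrace : hsNormSq (K * (V : Matrix n n ℂ) * K) =
      (((star V : unitaryGroup n ℂ) : Matrix n n ℂ) * (K * K) *
        ((V : Matrix n n ℂ) * (K * K))).trace.re := by
    rw [hsNormSq, Matrix.conjTranspose_mul, Matrix.conjTranspose_mul, hK.eq,
      ← Matrix.star_eq_conjTranspose, Unitary.coe_star, Matrix.mul_assoc K, Matrix.trace_mul_comm K]
    simp only [Matrix.mul_assoc]
  rw [htrace]
  refine (Complex.re_le_norm _).trans ((norm_trace_mul_le _ _).trans_eq ?_)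
  rw [hsNormSq_unitary_mul, hsNormSq_unitary_mul, Real.mul_self_sqrt (hsNormSq_nonneg _)]

theorem traceNorm_mul_mul_le {K : Matrix n n ℂ} (hK : K.IsHermitian) (M : Matrix n n ℂ) :
    traceNorm (K * M * K) ≤ √(hsNormSq (K * K)) * √(hsNormSq M) := by
  obtain ⟨V, hV⟩ := exists_unitary_re_trace_mul_eq (K * M * K)
  calc traceNorm (K * M * K) = (K * (V : Matrix n n ℂ) * K * M).trace.re := by
        rw [← hV, ← Matrix.mul_assoc, Matrix.trace_mul_comm]
        simp only [Matrix.mul_assoc]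
    _ ≤ √(hsNormSq (K * (V : Matrix n n ℂ) * K)) * √(hsNormSq M) :=
        (Complex.re_le_norm _).trans (norm_trace_mul_le _ _)
    _ ≤ √(hsNormSq (K * K)) * √(hsNormSq M) := by
        gcongr
        exact hsNormSq_mul_unitary_mul_le hK V

theorem traceNorm_conjTranspose (M : Matrix n n ℂ) : traceNorm Mᴴ = traceNorm M := by
  have hle (N : Matrix n n ℂ) : traceNorm Nᴴ ≤ traceNorm N := by
    obtain ⟨V, hV⟩ := exists_unitary_re_trace_mul_eq Nᴴ
    calc traceNorm Nᴴ = (((star V : unitaryGroup n ℂ) : Matrix n n ℂ) * N).trace.re := by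
          rw [← hV, ← re_trace_conjTranspose, Matrix.conjTranspose_mul,
            Matrix.conjTranspose_conjTranspose, Matrix.trace_mul_comm, Unitary.coe_star,
            Matrix.star_eq_conjTranspose]
      _ ≤ traceNorm N := re_trace_unitary_mul_le (star V) N
  exact (hle M).antisymm (by simpa only [Matrix.conjTranspose_conjTranspose] using hle Mᴴ)

theorem exists_posSemidef_sub_posSemidef {M : Matrix n n ℂ} (hM : M.IsHermitian) :
    ∃ P N : Matrix n n ℂ, P.PosSemidef ∧ N.PosSemidef ∧ M = P - N ∧
      P.trace.re + N.trace.re = traceNorm M := by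
  refine ⟨M⁺, M⁻, Matrix.nonneg_iff_posSemidef.1 (CFC.posPart_nonneg M),
    Matrix.nonneg_iff_posSemidef.1 (CFC.negPart_nonneg M), (CFC.posPart_sub_negPart M hM).symm, ?_⟩
  rw [← Complex.add_re, ← Matrix.trace_add, CFC.posPart_add_negPart M hM,
    traceNorm_eq_re_trace_abs]

end TraceNorm

section Fidelity

variable {n : Type*} [Fintype n] [DecidableEq n]

theorem traceNorm_mul_conjTranspose_sub_le (R S : Matrix n n ℂ) :
    traceNorm (R * Rᴴ - S * Sᴴ) ≤ √(hsNormSq (R - S)) * √(hsNormSq (R + S)) := by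
  have hsym : (R - S) * (R + S)ᴴ + ((R - S) * (R + S)ᴴ)ᴴ = (2 : ℂ) • (R * Rᴴ - S * Sᴴ) := by
    simp only [Matrix.conjTranspose_mul, Matrix.conjTranspose_add, Matrix.conjTranspose_sub,
      Matrix.conjTranspose_conjTranspose, two_smul]
    noncomm_ring
  have hprod : traceNorm ((R - S) * (R + S)ᴴ) ≤ √(hsNormSq (R - S)) * √(hsNormSq (R + S)) := by
    simpa only [hsNormSq_conjTranspose] using traceNorm_mul_le (R - S) (R + S)ᴴ
  have hadd := traceNorm_add_le ((R - S) * (R + S)ᴴ) ((R - S) * (R + S)ᴴ)ᴴ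
  rw [hsym, traceNorm_smul, traceNorm_conjTranspose, Complex.norm_ofNat] at hadd
  linarith

theorem hsNormSq_sqrt {ρ : Matrix n n ℂ} (hρ : ρ.PosSemidef) :
    hsNormSq (CFC.sqrt ρ) = ρ.trace.re := by
  have hsa : (CFC.sqrt ρ).IsHermitian := (CFC.sqrt_nonneg ρ).isSelfAdjoint
  rw [hsNormSq_of_isHermitian hsa, CFC.sqrt_mul_sqrt_self ρ hρ.nonneg]

theorem fidelity_nonneg (ρ σ : Matrix n n ℂ) : 0 ≤ fidelity ρ σ := traceNorm_nonneg _

theorem fidelity_sq_le {ρ σ : Matrix n n ℂ} (hρ : ρ.PosSemidef) (hσ : σ.PosSemidef) :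
    fidelity ρ σ ^ 2 ≤ ρ.trace.re * σ.trace.re := by
  have h := traceNorm_mul_le (CFC.sqrt ρ) (CFC.sqrt σ)
  rw [hsNormSq_sqrt hρ, hsNormSq_sqrt hσ, ← Real.sqrt_mul (re_trace_nonneg hρ)] at h
  exact (Real.le_sqrt (fidelity_nonneg ρ σ)
    (mul_nonneg (re_trace_nonneg hρ) (re_trace_nonneg hσ))).1 h

/-- Uhlmann's theorem: `C` is a purification of `σ` with optimal overlap with that of `ρ`. -/
theorem exists_mul_conjTranspose_eq_and_re_trace_eq_fidelity (ρ : Matrix n n ℂ)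
    {σ : Matrix n n ℂ} (hσ : σ.PosSemidef) :
    ∃ C : Matrix n n ℂ, C * Cᴴ = σ ∧ (CFC.sqrt ρ * C).trace.re = fidelity ρ σ := by
  obtain ⟨V, hV⟩ := exists_unitary_re_trace_mul_eq (CFC.sqrt ρ * CFC.sqrt σ)
  have hsa : (CFC.sqrt σ)ᴴ = CFC.sqrt σ := (CFC.sqrt_nonneg σ).isSelfAdjoint
  refine ⟨CFC.sqrt σ * (V : Matrix n n ℂ), ?_, ?_⟩
  · rw [Matrix.conjTranspose_mul, hsa, Matrix.mul_assoc, ← Matrix.mul_assoc _ _ (CFC.sqrt σ),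
      ← Matrix.star_eq_conjTranspose, Unitary.mul_star_self_of_mem V.2,
      Matrix.one_mul,
      CFC.sqrt_mul_sqrt_self σ hσ.nonneg]
  · rw [← Matrix.mul_assoc, Matrix.trace_mul_comm, hV, fidelity]

theorem sq_traceNorm_sub_le {ρ σ : Matrix n n ℂ} (hρ : ρ.PosSemidef) (hσ : σ.PosSemidef) :
    traceNorm (ρ - σ) ^ 2 ≤ (ρ.trace.re + σ.trace.re) ^ 2 - 4 * fidelity ρ σ ^ 2 := by
  obtain ⟨C, hC, hF⟩ := exists_mul_conjTranspose_eq_and_re_trace_eq_fidelity ρ hσ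
  have hsa : (CFC.sqrt ρ)ᴴ = CFC.sqrt ρ := (CFC.sqrt_nonneg ρ).isSelfAdjoint
  have hCnorm : hsNormSq C = σ.trace.re := by rw [hsNormSq, Matrix.trace_mul_comm, hC]
  have hle := traceNorm_mul_conjTranspose_sub_le (CFC.sqrt ρ) C
  rw [hC, hsa, CFC.sqrt_mul_sqrt_self ρ hρ.nonneg, ← Real.sqrt_mul (hsNormSq_nonneg _)] at hle
  calc traceNorm (ρ - σ) ^ 2 ≤ hsNormSq (CFC.sqrt ρ - C) * hsNormSq (CFC.sqrt ρ + C) :=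
        (Real.le_sqrt (traceNorm_nonneg _)
          (mul_nonneg (hsNormSq_nonneg _) (hsNormSq_nonneg _))).1 hle
    _ = (ρ.trace.re + σ.trace.re) ^ 2 - 4 * fidelity ρ σ ^ 2 := by
        rw [hsNormSq_sub, hsNormSq_add, hsa, hF, hsNormSq_sqrt hρ, hCnorm]
        ring

theorem traceNorm_sub_le_two_mul_purifiedDist {ρ σ : Matrix n n ℂ} (hρ : IsSubnormalized ρ)
    (hσ : IsSubnormalized σ) : traceNorm (ρ - σ) ≤ 2 * purifiedDist ρ σ := by
  have hr : 0 ≤ 1 - ρ.trace.re := sub_nonneg.2 hρ.2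
  have hs : 0 ≤ 1 - σ.trace.re := sub_nonneg.2 hσ.2
  have hr₀ := re_trace_nonneg hρ.1
  have hs₀ := re_trace_nonneg hσ.1
  have hF := fidelity_sq_le hρ.1 hσ.1
  have hdist := sq_traceNorm_sub_le hρ.1 hσ.1
  have hgg := Real.sq_sqrt (mul_nonneg hr hs)
  rw [purifiedDist, genFidelity, ← div_le_iff₀' two_pos]
  refine Real.le_sqrt_of_sq_le ?_
  set F := fidelity ρ σ
  set r := ρ.trace.re
  set s := σ.trace.re
  set g := √((1 - r) * (1 - s))
  have hcross : 2 * (F * g) ≤ r * (1 - r) + s * (1 - s) := by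
    refine (abs_le_of_sq_le_sq' ?_ (by positivity)).2
    calc (2 * (F * g)) ^ 2 = 4 * (F ^ 2 * ((1 - r) * (1 - s))) := by rw [← hgg]; ring
      _ ≤ 4 * ((r * s) * ((1 - r) * (1 - s))) := by gcongr
      _ ≤ (r * (1 - r) + s * (1 - s)) ^ 2 := by
          linarith [sq_nonneg (r * (1 - r) - s * (1 - s))]
  linarith [sq_nonneg (r - s)]

end Fidelity

section InvariantForms

theorem ext_of_isSymm_of_isHermitian {A : Type*} [Finite A]
    {Q R : LinearMap.BilinForm ℂ (Matrix A A ℂ)} (hQ : Q.IsSymm) (hR : R.IsSymm)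
    (h : ∀ X : Matrix A A ℂ, X.IsHermitian → Q X X = R X X) : Q = R := by
  classical
  have := Fintype.ofFinite A
  have hpair (X Y : selfAdjoint (Matrix A A ℂ)) : Q X Y = R X Y := by
    rw [hQ.polarization, hR.polarization, h X X.2, h Y Y.2, h _ (X.2.add Y.2)]
  refine LinearMap.ext_on span_selfAdjoint fun X hX => ?_
  exact LinearMap.ext_on span_selfAdjoint fun Y hY => hpair ⟨X, hX⟩ ⟨Y, hY⟩

theorem exists_eq_ite_of_perm_invariant {A R : Type*} [DecidableEq A] [Inhabited R] {q : A → A → R}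
    (hq : ∀ (s : Equiv.Perm A) i j, q (s i) (s j) = q i j) :
    ∃ p r, ∀ i j, q i j = if i = j then p else r := by
  have hdiag : ∃ p, ∀ i, q i i = p := by
    rcases isEmpty_or_nonempty A with _ | ⟨⟨a⟩⟩
    · exact ⟨default, isEmptyElim⟩
    · exact ⟨q a a, fun i => by rw [← hq (Equiv.swap a i) a a, Equiv.swap_apply_left]⟩
  have hoff : ∃ r, ∀ i j, i ≠ j → q i j = r := by
    rcases subsingleton_or_nontrivial A with _ | _
    · exact ⟨default, fun i j hij => (hij (Subsingleton.elim i j)).elim⟩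
    · obtain ⟨a, b, hab⟩ := exists_pair_ne A
      refine ⟨q a b, fun i j hij => ?_⟩
      obtain ⟨s, rfl, rfl⟩ := MulAction.is_two_pretransitive_iff.1
        (Equiv.Perm.isMultiplyPretransitive A 2) hab hij
      exact hq s a b
  obtain ⟨⟨p, hp⟩, r, hr⟩ := And.intro hdiag hoff
  refine ⟨p, r, fun i j => ?_⟩
  split_ifs with hij
  · rw [hij, hp]
  · exact hr i j hij

variable {A : Type*} [Fintype A]

/-- The bilinear form `(X, Y) ↦ tr (X Y)`. -/
def traceMulForm (A : Type*) [Fintype A] : LinearMap.BilinForm ℂ (Matrix A A ℂ) :=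
  (LinearMap.mul ℂ (Matrix A A ℂ)).compr₂ (Matrix.traceLinearMap A ℂ ℂ)

/-- The bilinear form `(X, Y) ↦ tr X tr Y`. -/
def traceTraceForm (A : Type*) [Fintype A] : LinearMap.BilinForm ℂ (Matrix A A ℂ) :=
  (LinearMap.mul ℂ ℂ).compl₁₂ (Matrix.traceLinearMap A ℂ ℂ) (Matrix.traceLinearMap A ℂ ℂ)

theorem traceMulForm_apply (X Y : Matrix A A ℂ) : traceMulForm A X Y = (X * Y).trace := rfl

theorem traceTraceForm_apply (X Y : Matrix A A ℂ) :
    traceTraceForm A X Y = X.trace * Y.trace := rfl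

theorem isSymm_traceMulForm : (traceMulForm A).IsSymm := ⟨Matrix.trace_mul_comm⟩

theorem isSymm_traceTraceForm : (traceTraceForm A).IsSymm := ⟨fun _ _ => mul_comm _ _⟩

variable [DecidableEq A]

/-- Conjugation `X ↦ U X U†` by a unitary, as an automorphism of the matrix algebra. -/
noncomputable abbrev unitaryConj (U : unitaryGroup A ℂ) : Matrix A A ℂ ≃⋆ₐ[ℂ] Matrix A A ℂ :=
  Unitary.conjStarAlgAut ℂ (Matrix A A ℂ) U

theorem trace_unitaryConj (U : unitaryGroup A ℂ) (X : Matrix A A ℂ) :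
    (unitaryConj U X).trace = X.trace := by
  rw [Unitary.conjStarAlgAut_apply, Matrix.trace_mul_comm, ← Matrix.mul_assoc,
    Unitary.coe_star_mul_self, Matrix.one_mul]

theorem exists_unitaryConj_single_eq (s : Equiv.Perm A) : ∃ U : unitaryGroup A ℂ,
    ∀ i, unitaryConj U (Matrix.single i i 1) = Matrix.single (s i) (s i) 1 := by
  have hs : s⁻¹.permMatrix ℂ * star (s⁻¹.permMatrix ℂ) = 1 := by
    rw [Matrix.star_eq_conjTranspose, Matrix.conjTranspose_permMatrix, ← Matrix.permMatrix_mul,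
      inv_inv, mul_inv_cancel, Matrix.permMatrix_one]
  refine ⟨⟨s⁻¹.permMatrix ℂ, Matrix.mem_unitaryGroup_iff.2 hs⟩, fun i => ?_⟩
  have hconj (X : Matrix A A ℂ) :
      s⁻¹.permMatrix ℂ * X * star (s⁻¹.permMatrix ℂ) = X.submatrix s.symm s.symm := by
    rw [Matrix.star_eq_conjTranspose, Matrix.conjTranspose_permMatrix, inv_inv,
      Equiv.Perm.permMatrix, PEquiv.toMatrix_toPEquiv_mul, Equiv.Perm.permMatrix,
      PEquiv.mul_toMatrix_toPEquiv, Matrix.submatrix_submatrix]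
    rfl
  rw [Unitary.conjStarAlgAut_apply, hconj]
  exact Matrix.submatrix_single_equiv s.symm s.symm i i 1

theorem apply_diagonal_diagonal (Q : LinearMap.BilinForm ℂ (Matrix A A ℂ)) (d e : A → ℂ) :
    Q (Matrix.diagonal d) (Matrix.diagonal e) =
      ∑ i, ∑ j, d i * e j * Q (Matrix.single i i 1) (Matrix.single j j 1) := by
  have hsum (d : A → ℂ) : Matrix.diagonal d = ∑ i, d i • Matrix.single i i (1 : ℂ) := by
    simp only [Matrix.smul_single, smul_eq_mul, mul_one, Matrix.sum_single_eq_diagonal]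
  rw [hsum d, hsum e, LinearMap.map_sum₂]
  simp only [map_sum, map_smul, LinearMap.smul_apply, smul_eq_mul, mul_assoc]
  exact Finset.sum_congr rfl fun i _ => Finset.sum_congr rfl fun j _ => mul_left_comm _ _ _

theorem exists_eq_smul_add_smul_of_unitaryConj_invariant
    {Q : LinearMap.BilinForm ℂ (Matrix A A ℂ)} (hQ : Q.IsSymm)
    (hinv : ∀ U X Y, Q (unitaryConj U X) (unitaryConj U Y) = Q X Y) :
    ∃ α γ : ℂ, Q = α • traceMulForm A + γ • traceTraceForm A := by
  obtain ⟨p, r, hpr⟩ := exists_eq_ite_of_perm_invariant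
    (q := fun i j : A => Q (Matrix.single i i 1) (Matrix.single j j 1)) fun s i j => by
      obtain ⟨U, hU⟩ := exists_unitaryConj_single_eq s
      rw [← hU, ← hU, hinv]
  have hdiag (d : A → ℂ) : Q (Matrix.diagonal d) (Matrix.diagonal d) =
      (p - r) * (∑ i, d i * d i) + r * ((∑ i, d i) * ∑ i, d i) := by
    have hterm (i j : A) : d i * d j * (if i = j then p else r) =
        (if i = j then (p - r) * (d i * d j) else 0) + r * (d i * d j) := by
      split_ifs <;> ring
    simp only [apply_diagonal_diagonal, hpr, hterm, Finset.sum_add_distrib, Finset.sum_ite_eq,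
      Finset.mem_univ, if_true, ← Finset.mul_sum, ← Finset.sum_mul]
  refine ⟨p - r, r, ext_of_isSymm_of_isHermitian hQ
    ((isSymm_traceMulForm.smul _).add (isSymm_traceTraceForm.smul _)) fun X hX => ?_⟩
  rw [hX.spectral_theorem, hinv, hdiag]
  simp only [LinearMap.add_apply, LinearMap.smul_apply, traceMulForm_apply, traceTraceForm_apply,
    smul_eq_mul, ← map_mul, trace_unitaryConj, Matrix.diagonal_mul_diagonal, Matrix.trace_diagonal]

end InvariantForms

section HaarMoments

variable {A : Type*} [Fintype A] [DecidableEq A]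

instance : (haarUnitary A).IsHaarMeasure := by unfold haarUnitary; infer_instance

instance : (haarUnitary A).IsMulRightInvariant where
  map_mul_right_eq_self g := by
    have : IsProbabilityMeasure ((haarUnitary A).map (· * g)) :=
      Measure.isProbabilityMeasure_map (continuous_mul_const g).aemeasurable
    exact Measure.isHaarMeasure_eq_of_isProbabilityMeasure _ _

theorem integrable_haarUnitary_of_continuous {F : Type*} [NormedAddCommGroup F]
    [SecondCountableTopology F] {f : unitaryGroup A ℂ → F} (hf : Continuous f) :
    Integrable f (haarUnitary A) :=
  hf.integrable_of_hasCompactSupport (HasCompactSupport.of_compactSpace f)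

theorem continuous_unitaryConj_apply (X : Matrix A A ℂ) :
    Continuous fun U : unitaryGroup A ℂ => unitaryConj U X := by
  simp only [Unitary.conjStarAlgAut_apply]
  fun_prop

theorem eq_trace_div_card_smul_one_of_commute_unitary {M : Matrix A A ℂ}
    (hM : ∀ V : unitaryGroup A ℂ, Commute (V : Matrix A A ℂ) M) :
    M = (M.trace / Fintype.card A) • (1 : Matrix A A ℂ) := by
  rcases isEmpty_or_nonempty A with _ | _
  · exact Subsingleton.elim _ _
  have hspan : Submodule.span ℂ (unitaryGroup A ℂ : Set (Matrix A A ℂ)) = ⊤ :=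
    CStarAlgebra.span_unitary _
  have hcomm (X : Matrix A A ℂ) : Commute X M := by
    have hX : X ∈ Submodule.span ℂ (unitaryGroup A ℂ : Set (Matrix A A ℂ)) := by
      rw [hspan]; exact Submodule.mem_top
    induction hX using Submodule.span_induction with
    | mem V hV => exact hM ⟨V, hV⟩
    | zero => exact Commute.zero_left M
    | add X Y _ _ hX hY => exact hX.add_left hY
    | smul c X _ hX => exact hX.smul_left c
  obtain ⟨c, rfl⟩ := Matrix.mem_range_scalar_of_commute_single fun i j _ => hcomm (.single i j 1)
  have hn : (Fintype.card A : ℂ) ≠ 0 := Nat.cast_ne_zero.2 Fintype.card_ne_zero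
  rw [Matrix.scalar_apply, ← Matrix.smul_one_eq_diagonal, Matrix.trace_smul, Matrix.trace_one,
    smul_eq_mul, mul_div_cancel_right₀ c hn]

theorem integral_unitaryConj (X : Matrix A A ℂ) :
    ∫ U, unitaryConj U X ∂haarUnitary A = (X.trace / Fintype.card A) • (1 : Matrix A A ℂ) := by
  have hint : Integrable (fun U => unitaryConj U X) (haarUnitary A) :=
    integrable_haarUnitary_of_continuous (continuous_unitaryConj_apply X)
  have hcomm (V : unitaryGroup A ℂ) : unitaryConj V (∫ U, unitaryConj U X ∂haarUnitary A) =
      ∫ U, unitaryConj U X ∂haarUnitary A := by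
    let φ := LinearMap.toContinuousLinearMap (unitaryConj V).toAlgEquiv.toLinearMap
    calc unitaryConj V (∫ U, unitaryConj U X ∂haarUnitary A)
        = ∫ U, unitaryConj V (unitaryConj U X) ∂haarUnitary A := (φ.integral_comp_comm hint).symm
      _ = ∫ U, unitaryConj (V * U) X ∂haarUnitary A := by
          simp only [Unitary.conjStarAlgAut_mul_apply]
      _ = ∫ U, unitaryConj U X ∂haarUnitary A :=
          integral_mul_left_eq_self (fun U => unitaryConj U X) V
  have htrace : (∫ U, unitaryConj U X ∂haarUnitary A).trace = X.trace := by
    let φ := LinearMap.toContinuousLinearMap (Matrix.traceLinearMap A ℂ ℂ)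
    calc (∫ U, unitaryConj U X ∂haarUnitary A).trace
        = ∫ U, (unitaryConj U X).trace ∂haarUnitary A := (φ.integral_comp_comm hint).symm
      _ = X.trace := by simp only [trace_unitaryConj, integral_const, probReal_univ, one_smul]
  rw [← htrace]
  refine eq_trace_div_card_smul_one_of_commute_unitary fun V => ?_
  rw [commute_iff_eq]
  nth_rw 2 [← hcomm V]
  rw [Unitary.conjStarAlgAut_apply, Matrix.mul_assoc, Unitary.coe_star_mul_self, Matrix.mul_one]

theorem continuous_apply_unitaryConj (Q : LinearMap.BilinForm ℂ (Matrix A A ℂ))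
    (X Y : Matrix A A ℂ) :
    Continuous fun U : unitaryGroup A ℂ => Q (unitaryConj U X) (unitaryConj U Y) := by
  let Q' : Matrix A A ℂ →ₗ[ℂ] Matrix A A ℂ →L[ℂ] ℂ :=
    LinearMap.toContinuousLinearMap.toLinearMap ∘ₗ Q
  exact (Q'.continuous_of_finiteDimensional.comp (continuous_unitaryConj_apply X)).clm_apply
    (continuous_unitaryConj_apply Y)

theorem integrable_apply_unitaryConj (Q : LinearMap.BilinForm ℂ (Matrix A A ℂ))
    (X Y : Matrix A A ℂ) :
    Integrable (fun U => Q (unitaryConj U X) (unitaryConj U Y)) (haarUnitary A) :=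
  integrable_haarUnitary_of_continuous (continuous_apply_unitaryConj Q X Y)

/-- The average of a bilinear form over simultaneous conjugation of its arguments. -/
noncomputable def twirl (Q : LinearMap.BilinForm ℂ (Matrix A A ℂ)) :
    LinearMap.BilinForm ℂ (Matrix A A ℂ) :=
  LinearMap.mk₂ ℂ (fun X Y => ∫ U, Q (unitaryConj U X) (unitaryConj U Y) ∂haarUnitary A)
    (fun X X' Y => by
      simp only [map_add, LinearMap.add_apply]
      exact integral_add (integrable_apply_unitaryConj Q X Y) (integrable_apply_unitaryConj Q X' Y))
    (fun c X Y => by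
      simp only [map_smul, LinearMap.smul_apply]
      exact integral_smul _ _)
    (fun X Y Y' => by
      simp only [map_add]
      exact integral_add (integrable_apply_unitaryConj Q X Y) (integrable_apply_unitaryConj Q X Y'))
    (fun c X Y => by
      simp only [map_smul]
      exact integral_smul _ _)

theorem twirl_apply (Q : LinearMap.BilinForm ℂ (Matrix A A ℂ)) (X Y : Matrix A A ℂ) :
    twirl Q X Y = ∫ U, Q (unitaryConj U X) (unitaryConj U Y) ∂haarUnitary A := rfl

theorem isSymm_twirl {Q : LinearMap.BilinForm ℂ (Matrix A A ℂ)} (hQ : Q.IsSymm) :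
    (twirl Q).IsSymm :=
  ⟨fun _ _ => integral_congr_ae (.of_forall fun _ => hQ.eq _ _)⟩

theorem twirl_unitaryConj (Q : LinearMap.BilinForm ℂ (Matrix A A ℂ)) (V : unitaryGroup A ℂ)
    (X Y : Matrix A A ℂ) : twirl Q (unitaryConj V X) (unitaryConj V Y) = twirl Q X Y := by
  simp only [twirl_apply, ← Unitary.conjStarAlgAut_mul_apply]
  exact integral_mul_right_eq_self (fun U => Q (unitaryConj U X) (unitaryConj U Y)) V

theorem twirl_one_one (Q : LinearMap.BilinForm ℂ (Matrix A A ℂ)) : twirl Q 1 1 = Q 1 1 := by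
  simp only [twirl_apply, map_one, integral_const, probReal_univ, one_smul]

/-- The contraction of a bilinear form with the swap operator `∑ E_ij ⊗ E_ji`. -/
def contraction (Q : LinearMap.BilinForm ℂ (Matrix A A ℂ)) : ℂ :=
  ∑ p : A × A, Q (Matrix.single p.1 p.2 1) (Matrix.single p.2 p.1 1)

theorem mul_single_mul (X Y : Matrix A A ℂ) (i j : A) : X * Matrix.single i j 1 * Y =
    ∑ q : A × A, (X q.1 i * Y j q.2) • Matrix.single q.1 q.2 1 := by
  rw [Matrix.matrix_eq_sum_single (X * Matrix.single i j 1 * Y), Fintype.sum_prod_type]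
  simp only [Matrix.smul_single, smul_eq_mul, mul_one, Matrix.mul_assoc]
  simp [Matrix.mul_apply, Matrix.single_apply, ite_and]

theorem sum_apply_mul_single_mul (Q : LinearMap.BilinForm ℂ (Matrix A A ℂ)) (X Y : Matrix A A ℂ) :
    ∑ p : A × A, Q (X * Matrix.single p.1 p.2 1 * Y) (Matrix.single p.2 p.1 1) =
      ∑ p : A × A, Q (Matrix.single p.1 p.2 1) (Y * Matrix.single p.2 p.1 1 * X) := by
  simp only [mul_single_mul, map_sum, map_smul, LinearMap.sum_apply, LinearMap.smul_apply]
  rw [Finset.sum_comm]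
  refine Finset.sum_congr rfl fun q _ => Fintype.sum_equiv (Equiv.prodComm A A) _ _ fun p => ?_
  rw [mul_comm (X q.1 p.1)]
  rfl

theorem sum_apply_unitaryConj_single (Q : LinearMap.BilinForm ℂ (Matrix A A ℂ))
    (U : unitaryGroup A ℂ) :
    ∑ p : A × A, Q (unitaryConj U (Matrix.single p.1 p.2 1))
      (unitaryConj U (Matrix.single p.2 p.1 1)) = contraction Q := by
  have hcancel (X : Matrix A A ℂ) : unitaryConj U (star (U : Matrix A A ℂ) * X * U) = X := by
    simpa only [Unitary.conjStarAlgAut_symm_apply] using (unitaryConj U).apply_symm_apply X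
  have h := sum_apply_mul_single_mul (Q.compl₁₂ LinearMap.id (unitaryConj U).toAlgEquiv.toLinearMap)
    (U : Matrix A A ℂ) (star U : unitaryGroup A ℂ)
  simp only [LinearMap.compl₁₂_apply, LinearMap.id_apply] at h
  simp only [contraction]
  refine h.trans ?_
  exact Finset.sum_congr rfl fun p _ => congrArg _ (hcancel _)

theorem contraction_twirl (Q : LinearMap.BilinForm ℂ (Matrix A A ℂ)) :
    contraction (twirl Q) = contraction Q := by
  rw [contraction]
  simp only [twirl_apply]
  rw [← integral_finsetSum _ fun p _ => integrable_apply_unitaryConj Q _ _]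
  simp only [sum_apply_unitaryConj_single, integral_const, probReal_univ, one_smul]

theorem contraction_traceMulForm : contraction (traceMulForm A) = (Fintype.card A : ℂ) ^ 2 := by
  simp [contraction, traceMulForm_apply, Fintype.card_prod, sq]

theorem contraction_traceTraceForm : contraction (traceTraceForm A) = Fintype.card A := by
  have htrace (i j : A) : (Matrix.single i j (1 : ℂ)).trace = if i = j then 1 else 0 := by
    simp [Matrix.trace, Matrix.single_apply, ite_and, eq_comm]
  simp [contraction, traceTraceForm_apply, Fintype.sum_prod_type, htrace]

theorem contraction_smul_add_smul (α γ : ℂ) (Q R : LinearMap.BilinForm ℂ (Matrix A A ℂ)) :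
    contraction (α • Q + γ • R) = α * contraction Q + γ * contraction R := by
  simp only [contraction, LinearMap.add_apply, LinearMap.smul_apply, smul_eq_mul,
    Finset.sum_add_distrib, Finset.mul_sum]

theorem card_mul_twirl_apply_of_trace_eq_zero {Q : LinearMap.BilinForm ℂ (Matrix A A ℂ)}
    (hQ : Q.IsSymm) {X : Matrix A A ℂ} (hX : X.trace = 0) (Y : Matrix A A ℂ) :
    ((Fintype.card A : ℂ) ^ 3 - Fintype.card A) * twirl Q X Y =
      (Fintype.card A * contraction Q - Q 1 1) * (X * Y).trace := by
  obtain ⟨α, γ, h⟩ :=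
    exists_eq_smul_add_smul_of_unitaryConj_invariant (isSymm_twirl hQ) (twirl_unitaryConj Q)
  have hXY : twirl Q X Y = α * (X * Y).trace := by
    rw [h, LinearMap.add_apply, LinearMap.add_apply, LinearMap.smul_apply, LinearMap.smul_apply,
      LinearMap.smul_apply, LinearMap.smul_apply, traceMulForm_apply, traceTraceForm_apply, hX,
      zero_mul, smul_zero, add_zero, smul_eq_mul]
  have hone : Q 1 1 = α * Fintype.card A + γ * (Fintype.card A) ^ 2 := by
    rw [← twirl_one_one, h]
    simp [traceMulForm_apply, traceTraceForm_apply, sq]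
  have hcon : contraction Q = α * (Fintype.card A) ^ 2 + γ * Fintype.card A := by
    rw [← contraction_twirl, h, contraction_smul_add_smul, contraction_traceMulForm,
      contraction_traceTraceForm]
  rw [hXY, hone, hcon]
  ring

end HaarMoments

section ChoiInverse

variable {A B E : Type*}

/-- The `(a, a')` block of an operator on `A B`, an operator on `B`. -/
abbrev fstBlock (C : Matrix (A × B) (A × B) ℂ) (a a' : A) : Matrix B B ℂ :=
  C.submatrix (Prod.mk a) (Prod.mk a')

/-- The `(e, e')` block of an operator on `A E`, an operator on `A`. -/
abbrev sndBlock (X : Matrix (A × E) (A × E) ℂ) (e e' : E) : Matrix A A ℂ :=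
  X.submatrix (·, e) (·, e')

theorem applyFst_sub (T : Matrix A A ℂ →ₗ[ℂ] Matrix B B ℂ) (X Y : Matrix (A × E) (A × E) ℂ) :
    applyFst E T (X - Y) = applyFst E T X - applyFst E T Y := by
  ext p q
  exact congrFun₂ (map_sub T (sndBlock X p.2 q.2) (sndBlock Y p.2 q.2)) p.1 q.1

theorem reduceFst_eq_sum_sndBlock [Fintype E] (X : Matrix (A × E) (A × E) ℂ) :
    reduceFst X = ∑ e, sndBlock X e e := by
  ext a a'
  simp [reduceFst, Matrix.sum_apply]

theorem trace_applyFst [Fintype B] [Fintype E] (T : Matrix A A ℂ →ₗ[ℂ] Matrix B B ℂ)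
    (X : Matrix (A × E) (A × E) ℂ) : (applyFst E T X).trace = (T (reduceFst X)).trace := by
  rw [reduceFst_eq_sum_sndBlock, map_sum, Matrix.trace_sum, Matrix.trace, Fintype.sum_prod_type,
    Finset.sum_comm]
  rfl

variable [Fintype A]

theorem trace_reduceFst [Fintype E] (X : Matrix (A × E) (A × E) ℂ) :
    (reduceFst X).trace = X.trace := by
  rw [Matrix.trace, Matrix.trace, Fintype.sum_prod_type]
  rfl

theorem reduceSnd_eq_sum_fstBlock (C : Matrix (A × B) (A × B) ℂ) :
    reduceSnd C = ∑ a, fstBlock C a a := by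
  ext b b'
  simp [reduceSnd, Matrix.sum_apply]

theorem posSemidef_reduceSnd {C : Matrix (A × B) (A × B) ℂ} (hC : C.PosSemidef) :
    (reduceSnd C).PosSemidef := by
  rw [reduceSnd_eq_sum_fstBlock]
  exact Matrix.posSemidef_sum _ fun a _ => hC.submatrix _

theorem trace_reduceSnd [Fintype B] (C : Matrix (A × B) (A × B) ℂ) :
    (reduceSnd C).trace = C.trace := by
  rw [Matrix.trace, Matrix.trace, Fintype.sum_prod_type_right]
  rfl

theorem trace_sndBlock (X : Matrix (A × E) (A × E) ℂ) (e e' : E) :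
    (sndBlock X e e').trace = reduceSnd X e e' := rfl

theorem trace_mul_eq_sum_fstBlock [Fintype B] (C D : Matrix (A × B) (A × B) ℂ) :
    (C * D).trace = ∑ p : A × A, (fstBlock C p.1 p.2 * fstBlock D p.2 p.1).trace := by
  simp only [Matrix.trace, Matrix.diag_apply, Matrix.mul_apply, Matrix.submatrix_apply,
    Fintype.sum_prod_type]
  exact Finset.sum_congr rfl fun a _ => Finset.sum_comm

theorem trace_mul_eq_sum_sndBlock [Fintype E] (X Y : Matrix (A × E) (A × E) ℂ) :
    (X * Y).trace = ∑ p : E × E, (sndBlock X p.1 p.2 * sndBlock Y p.2 p.1).trace := by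
  simp only [Matrix.trace, Matrix.diag_apply, Matrix.mul_apply, Matrix.submatrix_apply,
    Fintype.sum_prod_type]
  rw [Finset.sum_comm]
  refine Finset.sum_congr rfl fun e _ => ?_
  exact (Finset.sum_congr rfl fun a _ => Finset.sum_comm).trans Finset.sum_comm

/-- The linear map with Choi-Jamiołkowski operator `C`. -/
noncomputable def ofChoi (C : Matrix (A × B) (A × B) ℂ) : Matrix A A ℂ →ₗ[ℂ] Matrix B B ℂ :=
  (Fintype.card A : ℂ) • ∑ a, ∑ a', (Matrix.entryLinearMap ℂ ℂ a a').smulRight (fstBlock C a a')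

theorem ofChoi_apply (C : Matrix (A × B) (A × B) ℂ) (X : Matrix A A ℂ) :
    ofChoi C X = (Fintype.card A : ℂ) • ∑ a, ∑ a', X a a' • fstBlock C a a' := by
  simp [ofChoi, LinearMap.sum_apply]

theorem applyFst_ofChoi (C : Matrix (A × B) (A × B) ℂ) (X : Matrix (A × E) (A × E) ℂ) :
    applyFst E (ofChoi C) X =
      (Fintype.card A : ℂ) • ∑ a, ∑ a', fstBlock C a a' ⊗ₖ fstBlock X a a' := by
  ext p q
  simp [applyFst, ofChoi_apply, Matrix.sum_apply, mul_comm]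

theorem posSemidef_applyFst_ofChoi [Finite B] [Finite E]
    {C : Matrix (A × B) (A × B) ℂ} {X : Matrix (A × E) (A × E) ℂ}
    (hC : C.PosSemidef) (hX : X.PosSemidef) : (applyFst E (ofChoi C) X).PosSemidef := by
  classical
  have := Fintype.ofFinite B
  have := Fintype.ofFinite E
  obtain ⟨R, rfl⟩ := CStarAlgebra.nonneg_iff_eq_star_mul_self.1 hC.nonneg
  obtain ⟨S, rfl⟩ := CStarAlgebra.nonneg_iff_eq_star_mul_self.1 hX.nonneg
  let K := ∑ a, R.submatrix id (Prod.mk a) ⊗ₖ S.submatrix id (Prod.mk a)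
  have hK : applyFst E (ofChoi (star R * R)) (star S * S) = (Fintype.card A : ℂ) • (Kᴴ * K) := by
    simp only [K, applyFst_ofChoi, Matrix.conjTranspose_sum, Matrix.conjTranspose_kronecker,
      Matrix.sum_mul, Matrix.mul_sum, ← Matrix.mul_kronecker_mul]
    rw [Finset.sum_comm]
    rfl
  rw [hK]
  exact (Matrix.posSemidef_conjTranspose_mul_self K).smul (by positivity)

variable [DecidableEq A]

theorem ofChoi_single (C : Matrix (A × B) (A × B) ℂ) (a a' : A) :
    ofChoi C (Matrix.single a a' 1) = (Fintype.card A : ℂ) • fstBlock C a a' := by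
  simp [ofChoi_apply, Matrix.single_apply, ite_and]

theorem ofChoi_one (C : Matrix (A × B) (A × B) ℂ) :
    ofChoi C 1 = (Fintype.card A : ℂ) • reduceSnd C := by
  simp [ofChoi_apply, Matrix.one_apply, reduceSnd_eq_sum_fstBlock]

theorem card_smul_fstBlock_choi (T : Matrix A A ℂ →ₗ[ℂ] Matrix B B ℂ) (a a' : A) :
    (Fintype.card A : ℂ) • fstBlock (choi T) a a' = T (Matrix.single a a' 1) := by
  have hn : (Fintype.card A : ℂ) ≠ 0 := Nat.cast_ne_zero.2 (Fintype.card_pos_iff.2 ⟨a⟩).ne'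
  have hblock : (Matrix.of fun x x' => maxEntangled A (a, x) (a', x')) =
      (Fintype.card A : ℂ)⁻¹ • Matrix.single a a' 1 := by
    have hsqrt : (√(Fintype.card A : ℝ) : ℂ) * √(Fintype.card A : ℝ) = Fintype.card A := by
      rw [← Complex.ofReal_mul, Real.mul_self_sqrt (Nat.cast_nonneg _), Complex.ofReal_natCast]
    ext x x'
    by_cases hx : a = x <;> by_cases hx' : a' = x' <;>
      simp [maxEntangled, Matrix.vecMulVec_apply, hx, hx', ← mul_inv, hsqrt]
  have happly : fstBlock (choi T) a a' =
      T (Matrix.of fun x x' => maxEntangled A (a, x) (a', x')) := rfl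
  rw [happly, hblock, map_smul, smul_inv_smul₀ hn]

theorem ofChoi_choi (T : Matrix A A ℂ →ₗ[ℂ] Matrix B B ℂ) : ofChoi (choi T) = T := by
  refine Matrix.ext_linearMap ℂ fun a a' => LinearMap.ext_ring ?_
  simp [ofChoi_single, card_smul_fstBlock_choi]

theorem fstBlock_one_kronecker_mul [Fintype B] (L : Matrix B B ℂ) (C : Matrix (A × B) (A × B) ℂ)
    (a a' : A) : fstBlock (((1 : Matrix A A ℂ) ⊗ₖ L) * C) a a' = L * fstBlock C a a' := by
  ext b b'
  simp [Matrix.mul_apply, Fintype.sum_prod_type, Matrix.one_apply]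

theorem fstBlock_mul_one_kronecker [Fintype B] (C : Matrix (A × B) (A × B) ℂ) (L : Matrix B B ℂ)
    (a a' : A) : fstBlock (C * ((1 : Matrix A A ℂ) ⊗ₖ L)) a a' = fstBlock C a a' * L := by
  ext b b'
  simp [Matrix.mul_apply, Fintype.sum_prod_type, Matrix.one_apply]

theorem applyFst_ofChoi_mul_mul [Fintype B] [Fintype E]
    (L L' : Matrix B B ℂ) (M M' : Matrix E E ℂ)
    (C : Matrix (A × B) (A × B) ℂ) (X : Matrix (A × E) (A × E) ℂ) :
    applyFst E (ofChoi (((1 : Matrix A A ℂ) ⊗ₖ L) * C * ((1 : Matrix A A ℂ) ⊗ₖ L')))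
      (((1 : Matrix A A ℂ) ⊗ₖ M) * X * ((1 : Matrix A A ℂ) ⊗ₖ M')) =
      (L ⊗ₖ M) * applyFst E (ofChoi C) X * (L' ⊗ₖ M') := by
  simp only [applyFst_ofChoi, fstBlock_mul_one_kronecker, fstBlock_one_kronecker_mul,
    Matrix.mul_kronecker_mul, Matrix.mul_smul, Matrix.smul_mul, Finset.mul_sum, Finset.sum_mul]

end ChoiInverse

section LocalConjugation

variable {A B E : Type*} [Fintype A] [DecidableEq A] [Fintype E] [DecidableEq E]

theorem sndBlock_conjFst (U : unitaryGroup A ℂ) (X : Matrix (A × E) (A × E) ℂ) (e e' : E) :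
    sndBlock (conjFst U X) e e' = unitaryConj U (sndBlock X e e') := by
  ext a a'
  simp [conjFst, Unitary.conjStarAlgAut_apply, Matrix.mul_apply, Fintype.sum_prod_type,
    Matrix.one_apply, Matrix.star_apply, apply_ite star]

theorem reduceFst_conjFst (U : unitaryGroup A ℂ) (X : Matrix (A × E) (A × E) ℂ) :
    reduceFst (conjFst U X) = unitaryConj U (reduceFst X) := by
  simp only [reduceFst_eq_sum_sndBlock, sndBlock_conjFst, map_sum]

theorem conjFst_sub (U : unitaryGroup A ℂ) (X Y : Matrix (A × E) (A × E) ℂ) :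
    conjFst U (X - Y) = conjFst U X - conjFst U Y := by
  rw [conjFst, Matrix.mul_sub, Matrix.sub_mul, conjFst, conjFst]

theorem conjFst_mul (U : unitaryGroup A ℂ) (X Y : Matrix (A × E) (A × E) ℂ) :
    conjFst U (X * Y) = conjFst U X * conjFst U Y := by
  have hU : ((U : Matrix A A ℂ) ⊗ₖ (1 : Matrix E E ℂ))ᴴ * ((U : Matrix A A ℂ) ⊗ₖ 1) = 1 := by
    rw [Matrix.conjTranspose_kronecker, ← Matrix.mul_kronecker_mul, ← Matrix.star_eq_conjTranspose,
      Unitary.coe_star_mul_self, Matrix.conjTranspose_one, Matrix.one_mul, Matrix.one_kronecker_one]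
  rw [conjFst, conjFst, conjFst, ← Matrix.mul_assoc, Matrix.mul_assoc _ _ᴴ, ← Matrix.mul_assoc _ᴴ,
    ← Matrix.mul_assoc _ᴴ, hU, Matrix.one_mul, ← Matrix.mul_assoc]

theorem conjFst_kronecker (U : unitaryGroup A ℂ) (X : Matrix A A ℂ) (M : Matrix E E ℂ) :
    conjFst U (X ⊗ₖ M) = unitaryConj U X ⊗ₖ M := by
  simp only [conjFst, Matrix.conjTranspose_kronecker, Matrix.conjTranspose_one,
    ← Matrix.mul_kronecker_mul, Matrix.one_mul, Matrix.mul_one, Unitary.conjStarAlgAut_apply,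
    Matrix.star_eq_conjTranspose]

theorem posSemidef_conjFst (U : unitaryGroup A ℂ) {X : Matrix (A × E) (A × E) ℂ}
    (hX : X.PosSemidef) : (conjFst U X).PosSemidef :=
  hX.mul_mul_conjTranspose_same _

theorem continuous_applyFst_conjFst (T : Matrix A A ℂ →ₗ[ℂ] Matrix B B ℂ)
    (X : Matrix (A × E) (A × E) ℂ) :
    Continuous fun U : unitaryGroup A ℂ => applyFst E T (conjFst U X) := by
  refine continuous_matrix fun p q => ?_
  have hentry (U : unitaryGroup A ℂ) : applyFst E T (conjFst U X) p q =
      (Matrix.entryLinearMap ℂ ℂ p.1 q.1 ∘ₗ T) (unitaryConj U (sndBlock X p.2 q.2)) :=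
    congrArg (T · p.1 q.1) (sndBlock_conjFst U X p.2 q.2)
  simp only [hentry]
  exact (LinearMap.continuous_of_finiteDimensional _).comp (continuous_unitaryConj_apply _)

end LocalConjugation

section HaarAverages

variable {A B E : Type*} [Fintype A] [DecidableEq A] [Fintype B] [Fintype E] [DecidableEq E]

theorem integral_trace_applyFst_ofChoi [Nonempty A] (C : Matrix (A × B) (A × B) ℂ)
    (X : Matrix (A × E) (A × E) ℂ) :
    ∫ U, (applyFst E (ofChoi C) (conjFst U X)).trace ∂haarUnitary A = C.trace * X.trace := by
  let f := (Matrix.traceLinearMap B ℂ ℂ ∘ₗ ofChoi C).toContinuousLinearMap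
  have hf : ∫ U, f (unitaryConj U (reduceFst X)) ∂haarUnitary A =
      f (∫ U, unitaryConj U (reduceFst X) ∂haarUnitary A) :=
    f.integral_comp_comm (integrable_haarUnitary_of_continuous (continuous_unitaryConj_apply _))
  have hn : (Fintype.card A : ℂ) ≠ 0 := Nat.cast_ne_zero.2 Fintype.card_ne_zero
  simp only [trace_applyFst, reduceFst_conjFst]
  refine hf.trans ?_
  simp only [f, LinearMap.coe_toContinuousLinearMap', integral_unitaryConj, map_smul,
    LinearMap.comp_apply, ofChoi_one, Matrix.traceLinearMap_apply, trace_reduceFst,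
    trace_reduceSnd, smul_eq_mul]
  field_simp

theorem contraction_traceMulForm_ofChoi (C : Matrix (A × B) (A × B) ℂ) :
    contraction ((traceMulForm B).compl₁₂ (ofChoi C) (ofChoi C)) =
      (Fintype.card A : ℂ) ^ 2 * (C * C).trace := by
  simp only [contraction, LinearMap.compl₁₂_apply, traceMulForm_apply, ofChoi_single,
    Matrix.smul_mul, Matrix.mul_smul, Matrix.trace_smul, smul_smul, ← sq, smul_eq_mul,
    ← Finset.mul_sum, trace_mul_eq_sum_fstBlock]

theorem card_mul_integral_trace_applyFst_ofChoi_mul_self (C : Matrix (A × B) (A × B) ℂ)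
    {X : Matrix (A × E) (A × E) ℂ} (hX : reduceSnd X = 0) :
    ((Fintype.card A : ℂ) ^ 3 - Fintype.card A) *
        ∫ U, (applyFst E (ofChoi C) (conjFst U X) *
          applyFst E (ofChoi C) (conjFst U X)).trace ∂haarUnitary A =
      ((Fintype.card A : ℂ) ^ 3 * (C * C).trace -
        (Fintype.card A : ℂ) ^ 2 * (reduceSnd C * reduceSnd C).trace) * (X * X).trace := by
  let Q : LinearMap.BilinForm ℂ (Matrix A A ℂ) :=
    (traceMulForm B).compl₁₂ (ofChoi C) (ofChoi C)
  have hQ : Q.IsSymm := ⟨fun _ _ => isSymm_traceMulForm.eq _ _⟩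
  have hblocks (U : unitaryGroup A ℂ) :
      (applyFst E (ofChoi C) (conjFst U X) * applyFst E (ofChoi C) (conjFst U X)).trace =
        ∑ p : E × E,
          Q (unitaryConj U (sndBlock X p.1 p.2)) (unitaryConj U (sndBlock X p.2 p.1)) := by
    rw [trace_mul_eq_sum_sndBlock]
    simp only [← sndBlock_conjFst]
    rfl
  have htr (p : E × E) : (sndBlock X p.1 p.2).trace = 0 := by rw [trace_sndBlock, hX]; rfl
  have hone : Q 1 1 = (Fintype.card A : ℂ) ^ 2 * (reduceSnd C * reduceSnd C).trace := by
    simp only [Q, LinearMap.compl₁₂_apply, traceMulForm_apply, ofChoi_one, Matrix.smul_mul,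
      Matrix.mul_smul, Matrix.trace_smul, smul_smul, ← sq, smul_eq_mul]
  simp only [hblocks]
  rw [integral_finsetSum _ fun p _ => integrable_apply_unitaryConj Q _ _]
  simp only [← twirl_apply, Finset.mul_sum, card_mul_twirl_apply_of_trace_eq_zero hQ (htr _)]
  rw [← Finset.mul_sum, ← trace_mul_eq_sum_sndBlock, hone, contraction_traceMulForm_ofChoi]
  ring

end HaarAverages

section Deviation

variable {A B E : Type*} [Fintype A] [DecidableEq A]

/-- The part of `X` orthogonal to all the operators `1 ⊗ M`. -/
noncomputable def centered (X : Matrix (A × E) (A × E) ℂ) : Matrix (A × E) (A × E) ℂ :=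
  X - ((Fintype.card A : ℂ)⁻¹ • (1 : Matrix A A ℂ)) ⊗ₖ reduceSnd X

theorem reduceSnd_centered [Nonempty A] (X : Matrix (A × E) (A × E) ℂ) :
    reduceSnd (centered X) = 0 := by
  ext e e'
  simp [centered, reduceSnd]

variable [Fintype E] [DecidableEq E]

/-- The deviation of `T(U X U†)` from the product of its marginals, where `T` has Choi-Jamiołkowski
operator `C`; the norm in `decouplingError T ρ U` is that of `deviation (choi T) ρ U`. -/
noncomputable def deviation (C : Matrix (A × B) (A × B) ℂ) (X : Matrix (A × E) (A × E) ℂ)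
    (U : unitaryGroup A ℂ) : Matrix (B × E) (B × E) ℂ :=
  applyFst E (ofChoi C) (conjFst U X) - reduceSnd C ⊗ₖ reduceSnd X

theorem decouplingError_eq_traceNorm_deviation [Fintype B] [DecidableEq B]
    (T : Matrix A A ℂ →ₗ[ℂ] Matrix B B ℂ) (X : Matrix (A × E) (A × E) ℂ) (U : unitaryGroup A ℂ) :
    decouplingError T X U = traceNorm (deviation (choi T) X U) := by
  rw [deviation, ofChoi_choi, decouplingError]

theorem continuous_deviation (C : Matrix (A × B) (A × B) ℂ) (X : Matrix (A × E) (A × E) ℂ) :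
    Continuous (deviation C X) :=
  (continuous_applyFst_conjFst _ _).sub continuous_const

theorem deviation_eq_applyFst_centered [Nonempty A] (C : Matrix (A × B) (A × B) ℂ)
    (X : Matrix (A × E) (A × E) ℂ) (U : unitaryGroup A ℂ) :
    deviation C X U = applyFst E (ofChoi C) (conjFst U (centered X)) := by
  have hn : (Fintype.card A : ℂ) ≠ 0 := Nat.cast_ne_zero.2 Fintype.card_ne_zero
  rw [centered, conjFst_sub, conjFst_kronecker, applyFst_sub, applyFst_kronecker, map_smul, map_one,
    map_smul, ofChoi_one, inv_smul_smul₀ hn, deviation]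

theorem isHermitian_deviation [Finite B] {C : Matrix (A × B) (A × B) ℂ} (hC : C.PosSemidef)
    {X : Matrix (A × E) (A × E) ℂ} (hX : X.PosSemidef) (U : unitaryGroup A ℂ) :
    (deviation C X U).IsHermitian :=
  (posSemidef_applyFst_ofChoi hC (posSemidef_conjFst U hX)).1.sub
    ((posSemidef_reduceSnd hC).kronecker (posSemidef_reduceSnd hX)).1

end Deviation

section SecondMoment

theorem re_trace_mul_nonneg {n : Type*} [Fintype n] {P Q : Matrix n n ℂ} (hP : P.PosSemidef)
    (hQ : Q.PosSemidef) : 0 ≤ (P * Q).trace.re := by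
  classical
  obtain ⟨R, rfl⟩ := CStarAlgebra.nonneg_iff_eq_star_mul_self.1 hQ.nonneg
  rw [Matrix.star_eq_conjTranspose, ← Matrix.mul_assoc, Matrix.trace_mul_comm, ← Matrix.mul_assoc]
  exact re_trace_nonneg (hP.mul_mul_conjTranspose_same R)

theorem sum_hsNormSq_le_hsNormSq_sum {ι n : Type*} [Fintype n] (s : Finset ι)
    {P : ι → Matrix n n ℂ} (hP : ∀ i, (P i).PosSemidef) :
    ∑ i ∈ s, hsNormSq (P i) ≤ hsNormSq (∑ i ∈ s, P i) := by
  classical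
  induction s using Finset.induction_on with
  | empty => simp [hsNormSq]
  | insert i s hi ih =>
    have hcross := re_trace_mul_nonneg (hP i) (Matrix.posSemidef_sum s fun j _ => hP j)
    rw [Finset.sum_insert hi, Finset.sum_insert hi, hsNormSq_add, (hP i).1.eq]
    linarith

theorem hsNormSq_mul_conjTranspose_self {m n : Type*} [Fintype m] [Fintype n] (R : Matrix m n ℂ) :
    hsNormSq (R * Rᴴ) = hsNormSq (Rᴴ * R) := by
  rw [hsNormSq_of_isHermitian (Matrix.isHermitian_mul_conjTranspose_self R),
    hsNormSq_of_isHermitian (Matrix.isHermitian_conjTranspose_mul_self R), Matrix.mul_assoc,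
    Matrix.trace_mul_comm]
  simp only [Matrix.mul_assoc]

theorem trace_mul_self_of_isHermitian {n : Type*} [Fintype n] {M : Matrix n n ℂ}
    (hM : M.IsHermitian) : (M * M).trace = hsNormSq M := by
  have hpos := (Matrix.posSemidef_conjTranspose_mul_self M).trace_nonneg
  rw [hM.eq] at hpos
  rw [hsNormSq_of_isHermitian hM]
  exact Complex.eq_re_of_ofReal_le hpos

theorem hsNormSq_fstBlock_le {A B : Type*} [Finite A] [Fintype B]
    {C : Matrix (A × B) (A × B) ℂ} (hC : C.PosSemidef) (a a' : A) :
    hsNormSq (fstBlock C a a') ≤ √(hsNormSq (fstBlock C a a)) * √(hsNormSq (fstBlock C a' a')) := by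
  classical
  have := Fintype.ofFinite A
  obtain ⟨R, rfl⟩ := CStarAlgebra.nonneg_iff_eq_star_mul_self.1 hC.nonneg
  let S (a : A) : Matrix (A × B) B ℂ := R.submatrix id (Prod.mk a)
  have hblock (a a' : A) : fstBlock (star R * R) a a' = (S a)ᴴ * S a' := rfl
  have htrace : hsNormSq ((S a)ᴴ * S a') = (S a * (S a)ᴴ * (S a' * (S a')ᴴ)).trace.re := by
    rw [hsNormSq, Matrix.conjTranspose_mul, Matrix.conjTranspose_conjTranspose, Matrix.mul_assoc,
      Matrix.trace_mul_comm]
    simp only [Matrix.mul_assoc]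
  rw [hblock, hblock, hblock, htrace, ← hsNormSq_mul_conjTranspose_self,
    ← hsNormSq_mul_conjTranspose_self]
  exact (Complex.re_le_norm _).trans (norm_trace_mul_le _ _)

variable {A B E : Type*} [Fintype A] [Fintype B]

theorem hsNormSq_eq_sum_fstBlock (C : Matrix (A × B) (A × B) ℂ) :
    hsNormSq C = ∑ a, ∑ a', hsNormSq (fstBlock C a a') := by
  simp only [hsNormSq_eq_sum, Fintype.sum_prod_type, Matrix.submatrix_apply]
  exact Finset.sum_congr rfl fun a _ => Finset.sum_comm

theorem hsNormSq_le_card_mul_hsNormSq_reduceSnd {C : Matrix (A × B) (A × B) ℂ}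
    (hC : C.PosSemidef) : hsNormSq C ≤ Fintype.card A * hsNormSq (reduceSnd C) := by
  calc hsNormSq C
      ≤ ∑ a, ∑ a', √(hsNormSq (fstBlock C a a)) * √(hsNormSq (fstBlock C a' a')) := by
        rw [hsNormSq_eq_sum_fstBlock]
        gcongr with a _ a' _
        exact hsNormSq_fstBlock_le hC a a'
    _ = (∑ a, √(hsNormSq (fstBlock C a a))) ^ 2 := by rw [sq, Finset.sum_mul_sum]
    _ ≤ Fintype.card A * ∑ a, √(hsNormSq (fstBlock C a a)) ^ 2 := sq_sum_le_card_mul_sum_sq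
    _ = Fintype.card A * ∑ a, hsNormSq (fstBlock C a a) := by
        simp only [Real.sq_sqrt (hsNormSq_nonneg _)]
    _ ≤ Fintype.card A * hsNormSq (reduceSnd C) := by
        rw [reduceSnd_eq_sum_fstBlock]
        gcongr
        exact sum_hsNormSq_le_hsNormSq_sum _ fun a => hC.submatrix _

variable [DecidableEq A]

theorem reduceSnd_one_kronecker_mul_mul (L : Matrix B B ℂ) (C : Matrix (A × B) (A × B) ℂ)
    (L' : Matrix B B ℂ) :
    reduceSnd (((1 : Matrix A A ℂ) ⊗ₖ L) * C * ((1 : Matrix A A ℂ) ⊗ₖ L')) =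
      L * reduceSnd C * L' := by
  simp only [reduceSnd_eq_sum_fstBlock, fstBlock_mul_one_kronecker, fstBlock_one_kronecker_mul,
    Matrix.mul_sum, Matrix.sum_mul]

theorem isHermitian_centered {X : Matrix (A × E) (A × E) ℂ} (hX : X.PosSemidef) :
    (centered X).IsHermitian := by
  refine hX.1.sub ?_
  rw [Matrix.IsHermitian, Matrix.conjTranspose_kronecker, (posSemidef_reduceSnd hX).1.eq]
  simp

theorem centered_eq_zero_of_subsingleton [Nonempty A] [Subsingleton A]
    (X : Matrix (A × E) (A × E) ℂ) : centered X = 0 := by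
  ext ⟨a, e⟩ ⟨a', e'⟩
  have hentry := congrFun₂ (reduceSnd_centered X) e e'
  rw [reduceSnd, Matrix.of_apply, Fintype.sum_subsingleton _ a] at hentry
  rwa [Subsingleton.elim a' a]

variable [Fintype E]

theorem hsNormSq_centered_le [Nonempty A] {X : Matrix (A × E) (A × E) ℂ} (hX : X.PosSemidef) :
    hsNormSq (centered X) ≤ hsNormSq X := by
  classical
  set Z := ((Fintype.card A : ℂ)⁻¹ • (1 : Matrix A A ℂ)) ⊗ₖ reduceSnd X with hZ
  have horth : (centered X * Z).trace = 0 := by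
    have hred := reduceSnd_one_kronecker_mul_mul 1 (centered X) (reduceSnd X)
    rw [Matrix.one_kronecker_one, reduceSnd_centered, Matrix.one_mul, Matrix.one_mul,
      Matrix.zero_mul] at hred
    rw [hZ, Matrix.smul_kronecker, Matrix.mul_smul, Matrix.trace_smul, ← trace_reduceSnd, hred,
      Matrix.trace_zero, smul_zero]
  have hadd : hsNormSq X = hsNormSq (centered X) + hsNormSq Z := by
    conv_lhs => rw [← sub_add_cancel X Z]
    rw [hsNormSq_add]
    change _ + 2 * ((centered X)ᴴ * Z).trace.re = _
    rw [(isHermitian_centered hX).eq, horth, Complex.zero_re, mul_zero, add_zero]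
    rfl
  rw [hadd]
  exact le_add_of_nonneg_right (hsNormSq_nonneg Z)

variable [DecidableEq E]

theorem card_mul_integral_hsNormSq_deviation [Nonempty A] {C : Matrix (A × B) (A × B) ℂ}
    (hC : C.PosSemidef) {X : Matrix (A × E) (A × E) ℂ} (hX : X.PosSemidef) :
    ((Fintype.card A : ℝ) ^ 3 - Fintype.card A) *
        ∫ U, hsNormSq (deviation C X U) ∂haarUnitary A =
      ((Fintype.card A : ℝ) ^ 3 * hsNormSq C - (Fintype.card A : ℝ) ^ 2 * hsNormSq (reduceSnd C)) *
        hsNormSq (centered X) := by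
  have hcomplex := card_mul_integral_trace_applyFst_ofChoi_mul_self C (reduceSnd_centered X)
  simp only [← deviation_eq_applyFst_centered,
    trace_mul_self_of_isHermitian (isHermitian_deviation hC hX _),
    trace_mul_self_of_isHermitian hC.1, trace_mul_self_of_isHermitian (posSemidef_reduceSnd hC).1,
    trace_mul_self_of_isHermitian (isHermitian_centered hX)] at hcomplex
  rw [integral_complex_ofReal] at hcomplex
  exact_mod_cast congrArg Complex.re hcomplex

theorem integral_hsNormSq_deviation_le [Nonempty A] {C : Matrix (A × B) (A × B) ℂ}
    (hC : C.PosSemidef) {X : Matrix (A × E) (A × E) ℂ} (hX : X.PosSemidef) :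
    ∫ U, hsNormSq (deviation C X U) ∂haarUnitary A ≤ hsNormSq C * hsNormSq X := by
  rcases subsingleton_or_nontrivial A with hA | hA
  · have hzero (U : unitaryGroup A ℂ) : deviation C X U = 0 := by
      rw [deviation_eq_applyFst_centered, centered_eq_zero_of_subsingleton, conjFst,
        Matrix.mul_zero, Matrix.zero_mul, ← sub_self 0, applyFst_sub, sub_self]
    simp only [hzero, hsNormSq, Matrix.mul_zero, Matrix.trace_zero, Complex.zero_re,
      integral_zero]
    exact mul_nonneg (hsNormSq_nonneg C) (hsNormSq_nonneg X)
  set n : ℝ := (Fintype.card A : ℝ)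
  have hn : 1 < n := Nat.one_lt_cast.2 Fintype.one_lt_card
  have hcoeff : n ^ 3 * hsNormSq C - n ^ 2 * hsNormSq (reduceSnd C) ≤ (n ^ 3 - n) * hsNormSq C := by
    have := mul_le_mul_of_nonneg_left (hsNormSq_le_card_mul_hsNormSq_reduceSnd hC)
      (zero_le_one.trans hn.le)
    linarith
  have hpos : 0 < n ^ 3 - n := by nlinarith
  refine le_of_mul_le_mul_left ?_ hpos
  calc (n ^ 3 - n) * ∫ U, hsNormSq (deviation C X U) ∂haarUnitary A
      ≤ (n ^ 3 - n) * hsNormSq C * hsNormSq (centered X) := by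
        rw [card_mul_integral_hsNormSq_deviation hC hX]
        gcongr
        exact hsNormSq_nonneg _
    _ ≤ (n ^ 3 - n) * hsNormSq C * hsNormSq X := by
        gcongr
        · exact mul_nonneg hpos.le (hsNormSq_nonneg _)
        · exact hsNormSq_centered_le hX
    _ = (n ^ 3 - n) * (hsNormSq C * hsNormSq X) := mul_assoc _ _ _

end SecondMoment

section AverageDeviation

variable {A B E : Type*} [Fintype A]

theorem reduceSnd_sub (C D : Matrix (A × B) (A × B) ℂ) :
    reduceSnd (C - D) = reduceSnd C - reduceSnd D := by
  ext b b'
  simp only [reduceSnd, Matrix.of_apply, Matrix.sub_apply, Finset.sum_sub_distrib]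

variable [DecidableEq A] [Fintype E] [DecidableEq E]

theorem deviation_sub_left (C D : Matrix (A × B) (A × B) ℂ) (X : Matrix (A × E) (A × E) ℂ)
    (U : unitaryGroup A ℂ) : deviation (C - D) X U = deviation C X U - deviation D X U := by
  have hofChoi : ofChoi (C - D) = ofChoi C - ofChoi D := by
    ext Y : 1
    simp only [ofChoi_apply, LinearMap.sub_apply, ← smul_sub, ← Finset.sum_sub_distrib]
    rfl
  rw [deviation, hofChoi, reduceSnd_sub]
  ext p q
  simp only [deviation, applyFst, Matrix.sub_apply, Matrix.of_apply, LinearMap.sub_apply,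
    Matrix.kroneckerMap_apply, sub_mul]
  exact sub_sub_sub_comm _ _ _ _

theorem deviation_sub_right (C : Matrix (A × B) (A × B) ℂ) (X Y : Matrix (A × E) (A × E) ℂ)
    (U : unitaryGroup A ℂ) : deviation C (X - Y) U = deviation C X U - deviation C Y U := by
  rw [deviation, conjFst_sub, applyFst_sub, reduceSnd_sub]
  ext p q
  simp only [deviation, Matrix.sub_apply, Matrix.kroneckerMap_apply, mul_sub]
  exact sub_sub_sub_comm _ _ _ _

variable [Fintype B] [DecidableEq B]

/-- The Haar average over `U` of the decoupling error `‖deviation C X U‖₁`. -/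
noncomputable def averageDeviation (C : Matrix (A × B) (A × B) ℂ)
    (X : Matrix (A × E) (A × E) ℂ) : ℝ :=
  ∫ U, traceNorm (deviation C X U) ∂haarUnitary A

theorem integrable_traceNorm_deviation (C : Matrix (A × B) (A × B) ℂ)
    (X : Matrix (A × E) (A × E) ℂ) :
    Integrable (fun U => traceNorm (deviation C X U)) (haarUnitary A) :=
  integrable_haarUnitary_of_continuous (continuous_traceNorm.comp (continuous_deviation C X))

theorem averageDeviation_sub_left_le (C D : Matrix (A × B) (A × B) ℂ)
    (X : Matrix (A × E) (A × E) ℂ) :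
    averageDeviation (C - D) X ≤ averageDeviation C X + averageDeviation D X := by
  simp only [averageDeviation, deviation_sub_left]
  rw [← integral_add (integrable_traceNorm_deviation C X) (integrable_traceNorm_deviation D X)]
  refine integral_mono ?_ ((integrable_traceNorm_deviation C X).add
    (integrable_traceNorm_deviation D X)) fun U => traceNorm_sub_le _ _
  simpa only [deviation_sub_left] using integrable_traceNorm_deviation (C - D) X

theorem averageDeviation_sub_right_le (C : Matrix (A × B) (A × B) ℂ)
    (X Y : Matrix (A × E) (A × E) ℂ) :
    averageDeviation C (X - Y) ≤ averageDeviation C X + averageDeviation C Y := by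
  simp only [averageDeviation, deviation_sub_right]
  rw [← integral_add (integrable_traceNorm_deviation C X) (integrable_traceNorm_deviation C Y)]
  refine integral_mono ?_ ((integrable_traceNorm_deviation C X).add
    (integrable_traceNorm_deviation C Y)) fun U => traceNorm_sub_le _ _
  simpa only [deviation_sub_right] using integrable_traceNorm_deviation C (X - Y)

theorem averageDeviation_le_of_posSemidef [Nonempty A] {C : Matrix (A × B) (A × B) ℂ}
    (hC : C.PosSemidef) {X : Matrix (A × E) (A × E) ℂ} (hX : X.PosSemidef) :
    averageDeviation C X ≤ 2 * (C.trace.re * X.trace.re) := by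
  have hCX : (C.trace * X.trace).re = C.trace.re * X.trace.re := by
    rw [Complex.mul_re, ← (Complex.nonneg_iff.1 hC.trace_nonneg).2, zero_mul, sub_zero]
  have hint : Integrable (fun U => (applyFst E (ofChoi C) (conjFst U X)).trace)
      (haarUnitary A) :=
    integrable_haarUnitary_of_continuous (continuous_applyFst_conjFst _ _).matrix_trace
  have hre : Integrable (fun U => (applyFst E (ofChoi C) (conjFst U X)).trace.re)
      (haarUnitary A) := hint.re
  have hmoment : ∫ U, (applyFst E (ofChoi C) (conjFst U X)).trace.re ∂haarUnitary A =
      C.trace.re * X.trace.re := by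
    rw [← hCX, ← integral_trace_applyFst_ofChoi]
    exact integral_re hint
  have hbound (U : unitaryGroup A ℂ) : traceNorm (deviation C X U) ≤
      (applyFst E (ofChoi C) (conjFst U X)).trace.re + C.trace.re * X.trace.re := by
    refine (traceNorm_sub_le _ _).trans_eq ?_
    rw [traceNorm_of_posSemidef (posSemidef_applyFst_ofChoi hC (posSemidef_conjFst U hX)),
      traceNorm_of_posSemidef ((posSemidef_reduceSnd hC).kronecker (posSemidef_reduceSnd hX)),
      Matrix.trace_kronecker, trace_reduceSnd, trace_reduceSnd, hCX]
  calc averageDeviation C X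
      ≤ ∫ U, ((applyFst E (ofChoi C) (conjFst U X)).trace.re + C.trace.re * X.trace.re)
          ∂haarUnitary A :=
        integral_mono (integrable_traceNorm_deviation C X)
          (hre.add (integrable_const _)) hbound
    _ = 2 * (C.trace.re * X.trace.re) := by
        rw [integral_add hre (integrable_const _), integral_const, probReal_univ, one_smul, hmoment,
          two_mul]

theorem averageDeviation_le_of_isHermitian [Nonempty A] {C : Matrix (A × B) (A × B) ℂ}
    (hC : C.IsHermitian) {X : Matrix (A × E) (A × E) ℂ} (hX : X.IsHermitian) :
    averageDeviation C X ≤ 2 * (traceNorm C * traceNorm X) := by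
  obtain ⟨P, N, hP, hN, rfl, hPN⟩ := exists_posSemidef_sub_posSemidef hC
  obtain ⟨Q, R, hQ, hR, rfl, hQR⟩ := exists_posSemidef_sub_posSemidef hX
  rw [← hPN, ← hQR]
  linarith [averageDeviation_sub_left_le P N (Q - R), averageDeviation_sub_right_le P Q R,
    averageDeviation_sub_right_le N Q R, averageDeviation_le_of_posSemidef hP hQ,
    averageDeviation_le_of_posSemidef hP hR, averageDeviation_le_of_posSemidef hN hQ,
    averageDeviation_le_of_posSemidef hN hR]

end AverageDeviation

section LocalWeights

variable {A B E : Type*} [Fintype A] [DecidableEq A] [Fintype B] [Fintype E]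

/-- The operator `(1 ⊗ K) C (1 ⊗ K†)`, where `K` is an operator on the second factor: the local
filter by which marginals are reweighted before passing to Hilbert-Schmidt norms. -/
def filterSnd (K : Matrix B B ℂ) (C : Matrix (A × B) (A × B) ℂ) : Matrix (A × B) (A × B) ℂ :=
  ((1 : Matrix A A ℂ) ⊗ₖ K) * C * ((1 : Matrix A A ℂ) ⊗ₖ Kᴴ)

theorem filterSnd_sub (K : Matrix B B ℂ) (C D : Matrix (A × B) (A × B) ℂ) :
    filterSnd K (C - D) = filterSnd K C - filterSnd K D := by
  simp only [filterSnd, Matrix.mul_sub, Matrix.sub_mul]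

theorem filterSnd_one_kronecker (K M : Matrix B B ℂ) :
    filterSnd K ((1 : Matrix A A ℂ) ⊗ₖ M) = (1 : Matrix A A ℂ) ⊗ₖ (K * M * Kᴴ) := by
  simp only [filterSnd, ← Matrix.mul_kronecker_mul, Matrix.one_mul]

theorem filterSnd_filterSnd (K L : Matrix B B ℂ) (C : Matrix (A × B) (A × B) ℂ) :
    filterSnd K (filterSnd L C) = filterSnd (K * L) C := by
  have hmul (M N : Matrix B B ℂ) :
      (1 : Matrix A A ℂ) ⊗ₖ (M * N) = ((1 : Matrix A A ℂ) ⊗ₖ M) * ((1 : Matrix A A ℂ) ⊗ₖ N) := by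
    rw [← Matrix.mul_kronecker_mul, Matrix.one_mul]
  simp only [filterSnd, Matrix.conjTranspose_mul, hmul, Matrix.mul_assoc]

theorem filterSnd_one [DecidableEq B] (C : Matrix (A × B) (A × B) ℂ) : filterSnd 1 C = C := by
  rw [filterSnd, Matrix.conjTranspose_one, Matrix.one_kronecker_one, Matrix.one_mul,
    Matrix.mul_one]

theorem posSemidef_filterSnd (K : Matrix B B ℂ) {C : Matrix (A × B) (A × B) ℂ}
    (hC : C.PosSemidef) : (filterSnd K C).PosSemidef := by
  have := hC.mul_mul_conjTranspose_same ((1 : Matrix A A ℂ) ⊗ₖ K)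
  rwa [Matrix.conjTranspose_kronecker, Matrix.conjTranspose_one] at this

theorem deviation_filterSnd [DecidableEq E] (K : Matrix B B ℂ) (C : Matrix (A × B) (A × B) ℂ)
    (L : Matrix E E ℂ) (X : Matrix (A × E) (A × E) ℂ) (U : unitaryGroup A ℂ) :
    deviation (filterSnd K C) (filterSnd L X) U = (K ⊗ₖ L) * deviation C X U * (K ⊗ₖ L)ᴴ := by
  simp only [deviation, filterSnd, conjFst_mul, conjFst_kronecker, map_one, applyFst_ofChoi_mul_mul,
    reduceSnd_one_kronecker_mul_mul, Matrix.mul_kronecker_mul, Matrix.conjTranspose_kronecker,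
    Matrix.mul_sub, Matrix.sub_mul]

theorem hsNormSq_kronecker (M : Matrix B B ℂ) (N : Matrix E E ℂ) :
    hsNormSq (M ⊗ₖ N) = hsNormSq M * hsNormSq N := by
  simp only [hsNormSq_eq_sum, Fintype.sum_prod_type, Matrix.kroneckerMap_apply, norm_mul, mul_pow,
    Finset.sum_mul_sum]

theorem exists_posDef_mul_self_eq {n : Type*} [Fintype n] {σ : Matrix n n ℂ}
    (hσ : σ.PosDef) : ∃ S : Matrix n n ℂ, S.PosDef ∧ S * S = σ := by
  classical
  have hSS : CFC.sqrt σ * CFC.sqrt σ = σ := CFC.sqrt_mul_sqrt_self σ hσ.posSemidef.nonneg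
  refine ⟨CFC.sqrt σ, ?_, hSS⟩
  have hu : IsUnit (CFC.sqrt σ) := isUnit_of_mul_isUnit_left (hSS.symm ▸ hσ.isUnit)
  exact (Matrix.nonneg_iff_posSemidef.1 (CFC.sqrt_nonneg σ)).posDef_iff_isUnit.2 hu

variable [DecidableEq B]

theorem hsNormSq_filterSnd_inv_le {C : Matrix (A × B) (A × B) ℂ} (hC : C.PosSemidef)
    {K : Matrix B B ℂ} (hK : K.PosDef)
    (h : ((1 : Matrix A A ℂ) ⊗ₖ (K * K * (K * K)) - C).PosSemidef) :
    hsNormSq (filterSnd K⁻¹ C) ≤ C.trace.re := by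
  have hdet : IsUnit K.det := (Matrix.isUnit_iff_isUnit_det _).1 hK.isUnit
  have hinv : (K⁻¹)ᴴ = K⁻¹ := hK.1.inv
  have hpow : K⁻¹ * (K * K * (K * K)) * (K⁻¹)ᴴ = K * K := by
    rw [hinv, Matrix.mul_assoc K, ← Matrix.mul_assoc K⁻¹, Matrix.nonsing_inv_mul _ hdet,
      Matrix.one_mul, Matrix.mul_assoc, Matrix.mul_assoc, Matrix.mul_nonsing_inv _ hdet,
      Matrix.mul_one]
  have htrace : (filterSnd K⁻¹ C * ((1 : Matrix A A ℂ) ⊗ₖ (K * K))).trace = C.trace := by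
    have hcancel : ((1 : Matrix A A ℂ) ⊗ₖ K⁻¹) * ((1 : Matrix A A ℂ) ⊗ₖ (K * K)) *
        ((1 : Matrix A A ℂ) ⊗ₖ K⁻¹) = 1 := by
      rw [← Matrix.mul_kronecker_mul, ← Matrix.mul_kronecker_mul, Matrix.one_mul, Matrix.one_mul,
        ← Matrix.mul_assoc, Matrix.nonsing_inv_mul _ hdet, Matrix.one_mul,
        Matrix.mul_nonsing_inv _ hdet, Matrix.one_kronecker_one]
    rw [filterSnd, hinv, Matrix.mul_assoc, Matrix.mul_assoc, Matrix.trace_mul_comm,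
      Matrix.mul_assoc, hcancel, Matrix.mul_one]
  have hfilter := posSemidef_filterSnd K⁻¹ hC
  have hpos := re_trace_mul_nonneg hfilter (posSemidef_filterSnd K⁻¹ h)
  rw [filterSnd_sub, filterSnd_one_kronecker, hpow, Matrix.mul_sub, Matrix.trace_sub, htrace,
    Complex.sub_re, ← hsNormSq_of_isHermitian hfilter.1] at hpos
  exact sub_nonneg.1 hpos

variable [DecidableEq E]

theorem averageDeviation_filterSnd_le [Nonempty A] {C : Matrix (A × B) (A × B) ℂ}
    (hC : C.PosSemidef) {X : Matrix (A × E) (A × E) ℂ} (hX : X.PosSemidef) {K : Matrix B B ℂ}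
    (hK : K.IsHermitian) {L : Matrix E E ℂ} (hL : L.IsHermitian) :
    averageDeviation (filterSnd K C) (filterSnd L X) ≤
      √(hsNormSq (K * K) * hsNormSq (L * L)) * √(hsNormSq C * hsNormSq X) := by
  have hKL : (K ⊗ₖ L).IsHermitian := by
    rw [Matrix.IsHermitian, Matrix.conjTranspose_kronecker, hK.eq, hL.eq]
  have hpointwise (U : unitaryGroup A ℂ) :
      traceNorm (deviation (filterSnd K C) (filterSnd L X) U) ≤
        √(hsNormSq (K * K) * hsNormSq (L * L)) * √(hsNormSq (deviation C X U)) := by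
    rw [deviation_filterSnd, hKL.eq, ← hsNormSq_kronecker, Matrix.mul_kronecker_mul]
    exact traceNorm_mul_mul_le hKL _
  have hcont : Continuous fun U => hsNormSq (deviation C X U) :=
    continuous_hsNormSq.comp (continuous_deviation C X)
  have hsqrt : Integrable (fun U => √(hsNormSq (deviation C X U))) (haarUnitary A) :=
    integrable_haarUnitary_of_continuous hcont.sqrt
  have hjensen : ∫ U, √(hsNormSq (deviation C X U)) ∂haarUnitary A ≤
      √(∫ U, hsNormSq (deviation C X U) ∂haarUnitary A) :=
    Real.strictConcaveOn_sqrt.concaveOn.le_map_integral Real.continuous_sqrt.continuousOn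
      isClosed_Ici (.of_forall fun _ => hsNormSq_nonneg _)
      (integrable_haarUnitary_of_continuous hcont) hsqrt
  calc averageDeviation (filterSnd K C) (filterSnd L X)
      ≤ ∫ U, √(hsNormSq (K * K) * hsNormSq (L * L)) * √(hsNormSq (deviation C X U))
          ∂haarUnitary A :=
        integral_mono (integrable_traceNorm_deviation _ _) (hsqrt.const_mul _) hpointwise
    _ ≤ √(hsNormSq (K * K) * hsNormSq (L * L)) * √(hsNormSq C * hsNormSq X) := by
        rw [integral_const_mul]
        gcongr
        exact hjensen.trans (Real.sqrt_le_sqrt (integral_hsNormSq_deviation_le hC hX))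

theorem averageDeviation_le_sqrt_mul [Nonempty A] {C : Matrix (A × B) (A × B) ℂ}
    (hC : C.PosSemidef) {X : Matrix (A × E) (A × E) ℂ} (hX : X.PosSemidef) {ω : Matrix B B ℂ}
    (hω : ω.PosDef) {σ : Matrix E E ℂ} (hσ : σ.PosDef)
    (hCω : ((1 : Matrix A A ℂ) ⊗ₖ ω - C).PosSemidef)
    (hXσ : ((1 : Matrix A A ℂ) ⊗ₖ σ - X).PosSemidef) :
    averageDeviation C X ≤ √(ω.trace.re * σ.trace.re) * √(C.trace.re * X.trace.re) := by
  obtain ⟨S, hS, rfl⟩ := exists_posDef_mul_self_eq hω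
  obtain ⟨K, hK, rfl⟩ := exists_posDef_mul_self_eq hS
  obtain ⟨T, hT, rfl⟩ := exists_posDef_mul_self_eq hσ
  obtain ⟨L, hL, rfl⟩ := exists_posDef_mul_self_eq hT
  have hKC : filterSnd K (filterSnd K⁻¹ C) = C := by
    rw [filterSnd_filterSnd, Matrix.mul_nonsing_inv _ hK.det_pos.ne'.isUnit, filterSnd_one]
  have hLX : filterSnd L (filterSnd L⁻¹ X) = X := by
    rw [filterSnd_filterSnd, Matrix.mul_nonsing_inv _ hL.det_pos.ne'.isUnit, filterSnd_one]
  have hfilter := averageDeviation_filterSnd_le (posSemidef_filterSnd K⁻¹ hC)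
    (posSemidef_filterSnd L⁻¹ hX) hK.1 hL.1
  rw [hKC, hLX, hsNormSq_of_isHermitian hS.1, hsNormSq_of_isHermitian hT.1] at hfilter
  refine hfilter.trans (mul_le_mul_of_nonneg_left (Real.sqrt_le_sqrt ?_) (Real.sqrt_nonneg _))
  exact mul_le_mul (hsNormSq_filterSnd_inv_le hC hK hCω) (hsNormSq_filterSnd_inv_le hX hL hXσ)
    (hsNormSq_nonneg _) (re_trace_nonneg hC)

end LocalWeights

section Smoothing

theorem nonempty_of_trace_eq_one {n : Type*} [Fintype n] {σ : Matrix n n ℂ}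
    (h : σ.trace = 1) : Nonempty n := by
  by_contra hn
  rw [not_nonempty_iff] at hn
  simp [Matrix.trace] at h

variable {A B E : Type*} [Fintype A] [DecidableEq A]

theorem exists_posDef_of_lt_minEntropy [Fintype B]
    {ρ : Matrix (A × B) (A × B) ℂ} {l : ℝ} (h : (l : EReal) < minEntropy ρ) :
    ∃ σ : Matrix B B ℂ, σ.PosDef ∧ σ.trace.re = (2 : ℝ) ^ (-l) ∧
      ((1 : Matrix A A ℂ) ⊗ₖ σ - ρ).PosSemidef := by
  classical
  simp only [minEntropy, lt_iSup_iff, EReal.coe_lt_coe_iff] at h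
  obtain ⟨σ, hσ, l', hρ, hl⟩ := h
  have : Nonempty B := nonempty_of_trace_eq_one hσ.2
  obtain ⟨s, hs⟩ : ∃ s : ℝ, s = ((2 : ℝ) ^ (-l) - (2 : ℝ) ^ (-l')) / Fintype.card B := ⟨_, rfl⟩
  have hs_pos : 0 < s := by
    have : (2 : ℝ) ^ (-l') < (2 : ℝ) ^ (-l) :=
      Real.rpow_lt_rpow_of_exponent_lt one_lt_two (neg_lt_neg hl)
    rw [hs]
    exact div_pos (sub_pos.2 this) (by positivity)
  refine ⟨(2 : ℝ) ^ (-l') • σ + s • 1, ?_, ?_, ?_⟩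
  · exact Matrix.PosDef.posSemidef_add (hσ.1.smul (by positivity)) (Matrix.PosDef.one.smul hs_pos)
  · rw [Matrix.trace_add, Matrix.trace_smul, Matrix.trace_smul, hσ.2, Matrix.trace_one,
      Complex.add_re, Complex.smul_re, Complex.smul_re, Complex.one_re, Complex.natCast_re,
      smul_eq_mul, smul_eq_mul, hs]
    field_simp
    ring
  · rw [Matrix.kronecker_add, Matrix.kronecker_smul, Matrix.kronecker_smul,
      Matrix.one_kronecker_one, add_sub_right_comm]
    exact hρ.add (Matrix.PosSemidef.one.smul hs_pos.le)

theorem bot_lt_minEntropy [Fintype B] [Nonempty B] {ρ : Matrix (A × B) (A × B) ℂ}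
    (hρ : ρ.PosSemidef) : ⊥ < minEntropy ρ := by
  classical
  set d : ℝ := (Fintype.card B : ℝ)
  have hd : 0 < d := Nat.cast_pos.2 Fintype.card_pos
  set c : ℝ := (‖ρ‖ + 1) * d with hc
  have hc_pos : 0 < c := by positivity
  have hσ : IsNormalized (d⁻¹ • (1 : Matrix B B ℂ)) := by
    refine ⟨Matrix.PosSemidef.one.smul (by positivity), ?_⟩
    rw [Matrix.trace_smul, Matrix.trace_one, Complex.real_smul, ← Complex.ofReal_natCast,
      ← Complex.ofReal_mul, inv_mul_cancel₀ hd.ne', Complex.ofReal_one]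
  have hρ_le : ρ ≤ (‖ρ‖ + 1) • (1 : Matrix (A × B) (A × B) ℂ) := by
    have hnorm := IsSelfAdjoint.le_algebraMap_norm_self (a := ρ) hρ.1
    rw [Algebra.algebraMap_eq_smul_one] at hnorm
    rw [add_smul, one_smul]
    exact hnorm.trans (le_add_of_nonneg_right Matrix.PosSemidef.one.nonneg)
  refine (EReal.bot_lt_coe (-Real.logb 2 c)).trans_le
    (le_iSup₂_of_le _ hσ (le_iSup₂_of_le (-Real.logb 2 c) ?_ le_rfl))
  rw [neg_neg, Real.rpow_logb two_pos (by norm_num) hc_pos, Matrix.kronecker_smul, smul_smul, hc,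
    mul_inv_cancel_right₀ hd.ne', Matrix.one_kronecker_one]
  exact hρ_le

theorem mem_smoothingBall_self {ρ : Matrix A A ℂ} (hρ : IsSubnormalized ρ) {ε : ℝ}
    (hε : 0 ≤ ε) : ρ ∈ smoothingBall ε ρ := by
  have hfid : fidelity ρ ρ = ρ.trace.re := by
    rw [fidelity, CFC.sqrt_mul_sqrt_self ρ hρ.1.nonneg, traceNorm_of_posSemidef hρ.1]
  have hgen : genFidelity ρ ρ = 1 := by
    rw [genFidelity, hfid, Real.sqrt_mul_self (sub_nonneg.2 hρ.2), add_sub_cancel]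
  refine ⟨hρ, ?_⟩
  rwa [purifiedDist, hgen, one_pow, sub_self, Real.sqrt_zero]

theorem traceNorm_le_one {ρ : Matrix A A ℂ} (hρ : IsSubnormalized ρ) : traceNorm ρ ≤ 1 :=
  (traceNorm_of_posSemidef hρ.1).trans_le hρ.2

theorem traceNorm_sub_le_of_mem_smoothingBall {ρ ρ' : Matrix A A ℂ} (hρ : IsSubnormalized ρ)
    {ε : ℝ} (h : ρ' ∈ smoothingBall ε ρ) : traceNorm (ρ' - ρ) ≤ 2 * ε :=
  (traceNorm_sub_le_two_mul_purifiedDist h.1 hρ).trans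
    (mul_le_mul_of_nonneg_left h.2 zero_le_two)

variable [Fintype B] [DecidableEq B]

theorem bot_lt_smoothMinEntropy [Nonempty B] {ρ : Matrix (A × B) (A × B) ℂ}
    (hρ : IsSubnormalized ρ) {ε : ℝ} (hε : 0 ≤ ε) : ⊥ < smoothMinEntropy ε ρ :=
  (bot_lt_minEntropy hρ.1).trans_le
    (le_iSup₂_of_le (f := fun ρ' (_ : ρ' ∈ smoothingBall ε ρ) => minEntropy ρ') ρ
      (mem_smoothingBall_self hρ hε) le_rfl)

variable [Fintype E] [DecidableEq E] [Nonempty A] {C : Matrix (A × B) (A × B) ℂ}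
  {X : Matrix (A × E) (A × E) ℂ} {l m : ℝ}

theorem averageDeviation_le_of_lt_minEntropy (hC : IsSubnormalized C) (hX : IsSubnormalized X)
    (hl : (l : EReal) < minEntropy C) (hm : (m : EReal) < minEntropy X) :
    averageDeviation C X ≤ (2 : ℝ) ^ (-(l + m) / 2) := by
  obtain ⟨ω, hω, hω_trace, hCω⟩ := exists_posDef_of_lt_minEntropy hl
  obtain ⟨σ, hσ, hσ_trace, hXσ⟩ := exists_posDef_of_lt_minEntropy hm
  have hweights : √(ω.trace.re * σ.trace.re) = (2 : ℝ) ^ (-(l + m) / 2) := by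
    rw [hω_trace, hσ_trace, ← Real.rpow_add two_pos, Real.sqrt_eq_rpow,
      ← Real.rpow_mul two_pos.le]
    ring_nf
  have htraces : √(C.trace.re * X.trace.re) ≤ 1 :=
    Real.sqrt_le_one.2 (mul_le_one₀ hC.2 (re_trace_nonneg hX.1) hX.2)
  calc averageDeviation C X
      ≤ √(ω.trace.re * σ.trace.re) * √(C.trace.re * X.trace.re) :=
        averageDeviation_le_sqrt_mul hC.1 hX.1 hω hσ hCω hXσ
    _ ≤ √(ω.trace.re * σ.trace.re) := mul_le_of_le_one_right (Real.sqrt_nonneg _) htraces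
    _ = (2 : ℝ) ^ (-(l + m) / 2) := hweights

theorem averageDeviation_le_of_lt_smoothMinEntropy (hC : IsSubnormalized C)
    (hX : IsSubnormalized X) {ε : ℝ} (hl : (l : EReal) < smoothMinEntropy ε C)
    (hm : (m : EReal) < smoothMinEntropy ε X) :
    averageDeviation C X ≤ (2 : ℝ) ^ (-(l + m) / 2) + 8 * ε := by
  simp only [smoothMinEntropy, lt_iSup_iff] at hl hm
  obtain ⟨C', hC', hl⟩ := hl
  obtain ⟨X', hX', hm⟩ := hm
  have hsmoothed := averageDeviation_le_of_lt_minEntropy hC'.1 hX'.1 hl hm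
  have htriangle_left : averageDeviation C X' ≤
      averageDeviation C' X' + averageDeviation (C' - C) X' := by
    simpa only [sub_sub_cancel] using averageDeviation_sub_left_le C' (C' - C) X'
  have htriangle_right : averageDeviation C X ≤
      averageDeviation C X' + averageDeviation C (X' - X) := by
    simpa only [sub_sub_cancel] using averageDeviation_sub_right_le C X' (X' - X)
  have hleft := averageDeviation_le_of_isHermitian (hC'.1.1.1.sub hC.1.1) hX'.1.1.1
  have hright := averageDeviation_le_of_isHermitian hC.1.1 (hX'.1.1.1.sub hX.1.1)
  have hleft_error : traceNorm (C' - C) * traceNorm X' ≤ 2 * ε :=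
    (mul_le_of_le_one_right (traceNorm_nonneg _) (traceNorm_le_one hX'.1)).trans
      (traceNorm_sub_le_of_mem_smoothingBall hC hC')
  have hright_error : traceNorm C * traceNorm (X' - X) ≤ 2 * ε :=
    (mul_le_of_le_one_left (traceNorm_nonneg _) (traceNorm_le_one hC)).trans
      (traceNorm_sub_le_of_mem_smoothingBall hX hX')
  linarith

end Smoothing

section CompletelyPositive

variable {A B : Type*} [Fintype A] [Fintype B] [DecidableEq B]

theorem posSemidef_comp_of_cstarMatrix_nonneg {M : CStarMatrix A A (Matrix B B ℂ)}
    (hM : 0 ≤ M) : (Matrix.comp A A B B ℂ (CStarMatrix.ofMatrix.symm M)).PosSemidef := by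
  rw [StarOrderedRing.nonneg_iff] at hM
  induction hM using AddSubmonoid.closure_induction with
  | mem M hM =>
    obtain ⟨N, rfl⟩ := hM
    let R := Matrix.comp A A B B ℂ (CStarMatrix.ofMatrix.symm N)
    have hR : Matrix.comp A A B B ℂ (CStarMatrix.ofMatrix.symm (star N * N)) = Rᴴ * R := by
      ext p q
      simp only [R, Matrix.comp_apply, Matrix.mul_apply, Fintype.sum_prod_type,
        Matrix.conjTranspose_apply, CStarMatrix.ofMatrix_symm_apply, CStarMatrix.mul_apply,
        CStarMatrix.star_apply, Matrix.sum_apply, Matrix.star_apply]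
    rw [hR]
    exact Matrix.posSemidef_conjTranspose_mul_self R
  | zero => exact Matrix.PosSemidef.zero
  | add M N _ _ hM hN => exact hM.add hN

variable [DecidableEq A]

theorem posSemidef_choi (T : Matrix A A ℂ →CP Matrix B B ℂ) :
    (choi T.toLinearMap).PosSemidef := by
  let M : CStarMatrix A A (Matrix A A ℂ) :=
    CStarMatrix.ofMatrix (Matrix.of fun a a' => Matrix.single a a' 1)
  have hM : ∀ a a', (star M * M) a a' = (Fintype.card A : ℂ) • Matrix.single a a' 1 := by
    intro a a'
    have hterm (x : A) : star (M x a) * M x a' = Matrix.single a a' 1 := by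
      simp [M, Matrix.star_eq_conjTranspose]
    simp [CStarMatrix.mul_apply, CStarMatrix.star_apply, hterm, ← Nat.cast_smul_eq_nsmul ℂ]
  have hpos := posSemidef_comp_of_cstarMatrix_nonneg
    (CompletelyPositiveMap.map_cstarMatrix_nonneg T _ (star_mul_self_nonneg M))
  suffices hchoi : choi T.toLinearMap = ((Fintype.card A : ℂ) ^ 2)⁻¹ • Matrix.comp A A B B ℂ
      (CStarMatrix.ofMatrix.symm ((star M * M).map T)) by
    rw [hchoi]
    exact hpos.smul (by positivity)
  ext ⟨a, b⟩ ⟨a', b'⟩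
  have hn : (Fintype.card A : ℂ) ≠ 0 := Nat.cast_ne_zero.2 (Fintype.card_pos_iff.2 ⟨a⟩).ne'
  have hblock : T ((star M * M) a a') =
      (Fintype.card A : ℂ) ^ 2 • fstBlock (choi T.toLinearMap) a a' := by
    rw [hM, map_smul, sq, mul_smul, card_smul_fstBlock_choi]
    rfl
  simp [hblock, hn]

end CompletelyPositive

section ExtendedReals

theorem ofReal_le_exp2_add_ofReal {I δ : ℝ} {x : EReal} (hδ : 0 ≤ δ)
    (h : ∀ r : ℝ, x < r → I ≤ (2 : ℝ) ^ r + δ) :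
    ENNReal.ofReal I ≤ exp2 x + ENNReal.ofReal δ := by
  have hexp (c : ℝ) : Continuous fun r : ℝ => (2 : ℝ) ^ r + c :=
    (Real.continuous_const_rpow two_ne_zero).add_const c
  induction x with
  | bot =>
    refine le_add_left (ENNReal.ofReal_le_ofReal (le_of_forall_pos_le_add fun η hη => ?_))
    have := h (Real.logb 2 η) (EReal.bot_lt_coe _)
    rwa [Real.rpow_logb two_pos (by norm_num) hη, add_comm] at this
  | coe x =>
    have hle : I ≤ (2 : ℝ) ^ x + δ :=
      ge_of_tendsto ((hexp δ).continuousWithinAt (s := Set.Ioi x))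
        (eventually_nhdsWithin_of_forall fun r hr => h r (EReal.coe_lt_coe_iff.2 hr))
    refine (ENNReal.ofReal_le_ofReal hle).trans_eq ?_
    exact ENNReal.ofReal_add (by positivity) hδ
  | top => exact le_add_right le_top

theorem exists_real_lt_of_neg_half_mul_sub_lt {H K : EReal} (hH : ⊥ < H) (hK : ⊥ < K) {r : ℝ}
    (hr : -((1 / 2 : ℝ) : EReal) * H - ((1 / 2 : ℝ) : EReal) * K < r) :
    ∃ l m : ℝ, (l : EReal) < H ∧ (m : EReal) < K ∧ -(l + m) / 2 ≤ r := by
  induction H with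
  | bot => exact absurd hH (lt_irrefl _)
  | top =>
    obtain ⟨m, -, hm⟩ := EReal.lt_iff_exists_real_btwn.1 hK
    exact ⟨-(2 * r) - m, m, EReal.coe_lt_top _, hm, by linarith⟩
  | coe h =>
    induction K with
    | bot => exact absurd hK (lt_irrefl _)
    | top =>
      exact ⟨h - 1, -(2 * r) - (h - 1), EReal.coe_lt_coe_iff.2 (by linarith),
        EReal.coe_lt_top _, by linarith⟩
    | coe k =>
      have hgap : -(h + k) / 2 < r := by
        have : -(1 / 2) * h - 1 / 2 * k < r := by exact_mod_cast hr
        linarith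
      exact ⟨h - (r + (h + k) / 2), k - (r + (h + k) / 2), EReal.coe_lt_coe_iff.2 (by linarith),
        EReal.coe_lt_coe_iff.2 (by linarith), by linarith⟩

end ExtendedReals

section DecouplingError

variable {A B E : Type*} [Fintype A] [DecidableEq A] [Fintype B] [DecidableEq B] [Fintype E]
  [DecidableEq E]

theorem decouplingError_of_isEmpty_left [IsEmpty A] (T : Matrix A A ℂ →ₗ[ℂ] Matrix B B ℂ)
    (X : Matrix (A × E) (A × E) ℂ) (U : unitaryGroup A ℂ) : decouplingError T X U = 0 := by
  have hsub : applyFst E T (conjFst U X) - reduceSnd (choi T) ⊗ₖ reduceSnd X = 0 := by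
    ext p q
    have hT (Y : Matrix A A ℂ) : T Y = 0 := by rw [Subsingleton.elim Y 0, map_zero]
    simp [applyFst, reduceSnd, hT]
  rw [decouplingError, hsub, traceNorm_zero]

theorem decouplingError_of_isEmpty_prod [IsEmpty (B × E)] (T : Matrix A A ℂ →ₗ[ℂ] Matrix B B ℂ)
    (X : Matrix (A × E) (A × E) ℂ) (U : unitaryGroup A ℂ) : decouplingError T X U = 0 := by
  rw [decouplingError, Subsingleton.elim (_ - _) 0, traceNorm_zero]

theorem averageDeviation_le_exp2 [Nonempty A] [Nonempty B] [Nonempty E]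
    {C : Matrix (A × B) (A × B) ℂ} (hC : IsSubnormalized C) {X : Matrix (A × E) (A × E) ℂ}
    (hX : IsSubnormalized X) {ε : ℝ} (hε : 0 ≤ ε) :
    ENNReal.ofReal (averageDeviation C X) ≤
      exp2 (-((1 / 2 : ℝ) : EReal) * smoothMinEntropy ε X
        - ((1 / 2 : ℝ) : EReal) * smoothMinEntropy ε C) + ENNReal.ofReal (8 * ε) := by
  refine ofReal_le_exp2_add_ofReal (by positivity) fun r hr => ?_
  obtain ⟨m, l, hm, hl, hlm⟩ := exists_real_lt_of_neg_half_mul_sub_lt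
    (bot_lt_smoothMinEntropy hX hε) (bot_lt_smoothMinEntropy hC hε) hr
  refine (averageDeviation_le_of_lt_smoothMinEntropy hC hX hl hm).trans ?_
  rw [add_comm l m]
  gcongr
  exact one_le_two

end DecouplingError

end Decoupling

open Decoupling in
theorem mainTheorem1_general {A B E : Type*} [Fintype A] [DecidableEq A] [Fintype B]
    [DecidableEq B] [Fintype E] [DecidableEq E] (ε : ℝ) (hε : 0 ≤ ε)
    (ρ : Matrix (A × E) (A × E) ℂ) (hρ : IsSubnormalized ρ)
    (T : Matrix A A ℂ →CP Matrix B B ℂ) (hT : (choi T.toLinearMap).trace.re ≤ 1) :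
    Integrable (fun U => decouplingError T.toLinearMap ρ U) (haarUnitary A) ∧
      ENNReal.ofReal (∫ U, decouplingError T.toLinearMap ρ U ∂haarUnitary A) ≤
        exp2 (-((1 / 2 : ℝ) : EReal) * smoothMinEntropy ε ρ
          - ((1 / 2 : ℝ) : EReal) * smoothMinEntropy ε (choi T.toLinearMap))
          + ENNReal.ofReal (8 * ε) := by
  obtain hA | hA := isEmpty_or_nonempty A
  · simp [decouplingError_of_isEmpty_left]
  obtain hBE | hBE := isEmpty_or_nonempty (B × E)
  · simp [decouplingError_of_isEmpty_prod]
  have hB : Nonempty B := hBE.map Prod.fst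
  have hE : Nonempty E := hBE.map Prod.snd
  simp only [decouplingError_eq_traceNorm_deviation]
  exact ⟨integrable_traceNorm_deviation _ _,
    averageDeviation_le_exp2 ⟨posSemidef_choi T, hT⟩ hρ hε⟩

theorem mainTheorem1 {A B E : Type*} [Fintype A] [DecidableEq A] [Fintype B] [DecidableEq B]
    [Fintype E] [DecidableEq E] (ε : ℝ) (hε : 0 < ε)
    (ρ : Matrix (A × E) (A × E) ℂ) (hρ : Decoupling.IsNormalized ρ)
    (T : Matrix A A ℂ →CP Matrix B B ℂ)
    (hT : (Decoupling.choi T.toLinearMap).trace.re ≤ 1) :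
    Integrable (fun U => Decoupling.decouplingError T.toLinearMap ρ U)
        (Decoupling.haarUnitary A) ∧
      ENNReal.ofReal (∫ U, Decoupling.decouplingError T.toLinearMap ρ U
          ∂(Decoupling.haarUnitary A)) ≤
        Decoupling.exp2
            (-((1 / 2 : ℝ) : EReal) * Decoupling.smoothMinEntropy ε ρ
              - ((1 / 2 : ℝ) : EReal) *
                Decoupling.smoothMinEntropy ε (Decoupling.choi T.toLinearMap))
          + ENNReal.ofReal (12 * ε) := by
  refine (mainTheorem1_general ε hε.le ρ ⟨hρ.1, by simp [hρ.2]⟩ T hT).imp_right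
    fun h => h.trans ?_
  gcongr
  norm_num
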